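/- **Setting.** Let $\mathcal G=(V,E,c,\partial V)$ be a finite connected weighted graph without loops (parallel edges allowed), with positive edge weights $c$ and nonempty boundary $\partial V\subset V$; put $V^\circ=V\setminus\partial V$. For a set $A$ of edges let $\mathrm{weight}(A)=\prod_{e\in A}c(e)$. The random spanning tree is a spanning tree of the graph obtained from $\mathcal G$ by wiring $\partial V$ into one vertex (the sink), chosen with probability proportional to its weight. The Laplacian on functions on $V^\circ$, extended by $0$ to $\partial V$, is $\Delta f(v)=\sum_{v'\sim v}c(vv')(f(v)-f(v'))$ (one term for each edge at $v$). Let $G=\Delta^{-1}$, extended by $0$ to the boundary, and let $T(xy,uv)=c(uv)\,(G(x,u)-G(y,u)-G(x,v)+G(y,v))$ be the wired transfer current. For a set $\mathcal E$ of edges, $\det(I-T)_{\mathcal E}$ is the minor of $I-T$ with rows and columns indexed by $\mathcal E$, each edge occurring once, with an arbitrary fixed orientation. **Sandpile.** A configuration is a map $\eta:V^\circ\to\mathbb N$; it is stable if $\eta(x)<\deg x$ for all $x$, where $\deg x$ is the number of edges at $x$. A vertex $x$ with $\eta(x)\ge\deg x$ may topple, sending one particle along each of its edges; particles that reach $\partial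 V$ are lost. The recurrent configurations are the recurrent states of the Markov chain on stable configurations which adds a particle at a uniformly chosen vertex of $V^\circ$ and then stabilizes. Let $W\subset V^\circ$ be such that every vertex of $V\setminus W$ is joined to $\partial V$ by a path in $V\setminus W$. A map $\xi:W\to\mathbb N$ is a minimal subconfiguration if it is the restriction of a recurrent configuration, but is no longer so when any one of its heights is decreased. **Burning bijection.** Fix an ordering of the edges around each vertex of $V^\circ$. Given a recurrent $\eta$, burn $\partial V$ first; then at each step burn simultaneously all unburnt vertices $v\in V^\circ\setminus W$ such that $\eta(v)\ge u(v)$, where $u(v)$ is the number of edges from $v$ to unburnt vertices. When this stops, restart the fire from the set of all burnt vertices (regarded as burnt in one step), now allowing every vertex of $V^\circ$ to burn, with the same rule. A vertex $v$ that burns selects, among its edges to the vertices burnt exactly one step earlier, the edge preceded by exactly $\eta(v)-u(v)$ others of these edges in the ordering around $v$. Let $\varphi(\eta)$ be the set of selected edges. Then $\varphi$ is a bijection from the recurrent configurations to the spanning trees of $\mathcal G$ with $\partial V$ wired. Let $\mathbb P$ be the pullback under $\varphi$ of the law of the random spanning tree. **Proposition 4.3.** Let $\mathcal G_W$ be the graph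 obtained from $\mathcal G$ by wiring all vertices of $V\setminus W$ (including $\partial V$) into one vertex and removing loops; its edges are the edges of $\mathcal G$ with at least one end in $W$. For a spanning tree $\mathcal T$ of $\mathcal G_W$ let $\mathcal E(\mathcal T)$ be the set of edges of $\mathcal G$ with at least one end in $W$ that are not in $\mathcal T$. Then for every minimal subconfiguration $\xi$ on $W$ there is a spanning tree $\mathcal T_0$ of $\mathcal G_W$, given by the burning bijection in the sense that, for every recurrent $\eta$ with $\eta_W=\xi$, the edges of $\varphi(\eta)$ with at least one end in $W$ are exactly those of $\mathcal T_0$, such that $$\mathbb P(\eta_W=\xi)=\det(I-T)_{\mathcal E(\mathcal T_0)}=\sum_{\mathcal T}\frac{\mathrm{weight}(\mathcal T_0)}{\sum_{\mathcal T'}\mathrm{weight}(\mathcal T')}\,\det(I-T)_{\mathcal E(\mathcal T)},$$ where both sums are over the spanning trees of $\mathcal G_W$. -/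

import Mathlib

/-- A finite weighted graph with boundary `(V, E, c, ∂V)`. Parallel edges are allowed. Every edge
carries an (arbitrary) reference orientation from `src` to `tgt`. Loops are allowed in the
structure only because wiring vertices together creates some. -/
structure WeightedGraph (V E : Type*) where
  src : E → V
  tgt : E → V
  c : E → ℝ
  c_pos : ∀ e, 0 < c e
  bdry : Finset V

namespace WeightedGraph

noncomputable section

/-! ### Graphs, wiring, spanning trees -/

/-- The interior vertices `V° = V \ ∂V`. -/
abbrev Interior {V E : Type*} (G : WeightedGraph V E) : Type _ := {v : V // v ∉ G.bdry}

/-- The simple graph on `V` in which distinct `x`, `y` are adjacent when an edge of `A` joins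
them. -/
def simple {V E : Type*} (G : WeightedGraph V E) (A : Finset E) : SimpleGraph V where
  Adj x y := x ≠ y ∧ ∃ e ∈ A, s(G.src e, G.tgt e) = s(x, y)
  symm := ⟨fun _ _ h => ⟨h.1.symm, by
    obtain ⟨e, he, h'⟩ := h.2
    exact ⟨e, he, h'.trans Sym2.eq_swap⟩⟩⟩
  loopless := ⟨fun _ h => h.1 rfl⟩

/-- `G` is connected. -/
def IsConn {V E : Type*} [Fintype E] (G : WeightedGraph V E) : Prop :=
  (G.simple Finset.univ).Connected

/-- `(V, A)` is a spanning tree: it is connected and has no cycle, where a cycle of a multigraph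
is a loop, a pair of parallel edges, or a cycle of the underlying simple graph. -/
def IsSpanningTree {V E : Type*} (G : WeightedGraph V E) (A : Finset E) : Prop :=
  (∀ e ∈ A, G.src e ≠ G.tgt e) ∧
  (∀ e ∈ A, ∀ f ∈ A, s(G.src e, G.tgt e) = s(G.src f, G.tgt f) → e = f) ∧
  (G.simple A).IsTree

/-- The finite set of all spanning trees. -/
def spanningTrees {V E : Type*} [Fintype E] (G : WeightedGraph V E) : Finset (Finset E) :=
  open Classical in Finset.univ.filter fun A => G.IsSpanningTree A

/-- The weight of a set of edges: the product of the edge weights. -/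
def weight {V E : Type*} (G : WeightedGraph V E) (A : Finset E) : ℝ := ∏ e ∈ A, G.c e

/-- The weighted number of spanning trees. -/
def treeSum {V E : Type*} [Fintype E] (G : WeightedGraph V E) : ℝ :=
  ∑ A ∈ G.spanningTrees, G.weight A

/-- The graph obtained from `G` by wiring all vertices of the (nonempty) set `S` into one vertex
`none`. The edges are those of `G`; an edge inside `S` becomes a loop, which no spanning tree
contains, so that it does not matter for spanning trees whether these loops are removed. -/
def wire {V E : Type*} [DecidableEq V] (G : WeightedGraph V E) (S : Finset V) :
    WeightedGraph (Option {v : V // v ∉ S}) E where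
  src e := if h : G.src e ∈ S then none else some ⟨G.src e, h⟩
  tgt e := if h : G.tgt e ∈ S then none else some ⟨G.tgt e, h⟩
  c := G.c
  c_pos := G.c_pos
  bdry := {none}

/-- The graph with its whole boundary wired into one vertex (the sink). -/
abbrev wired {V E : Type*} [DecidableEq V] (G : WeightedGraph V E) :
    WeightedGraph (Option {v : V // v ∉ G.bdry}) E :=
  G.wire G.bdry

/-- The edges that join `v` to a vertex of `X`. -/
def edgesTo {V E : Type*} [Fintype E] [DecidableEq V] (G : WeightedGraph V E) (v : V)
    (X : Finset V) : Finset E :=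
  Finset.univ.filter fun e => (G.src e = v ∧ G.tgt e ∈ X) ∨ (G.tgt e = v ∧ G.src e ∈ X)

/-- The degree: the number of edges at `v`. -/
def deg {V E : Type*} [Fintype V] [Fintype E] [DecidableEq V] (G : WeightedGraph V E) (v : V) :
    ℕ :=
  (G.edgesTo v Finset.univ).card

/-! ### Laplacian, Green function, transfer current (wired boundary condition) -/

/-- The matrix of `Δ f (v) = ∑_{v' ∼ v} c(vv') (f(v) - f(v'))` on functions on the interior
vertices, extended by `0` to the boundary. -/
def laplacian {V E : Type*} [Fintype V] [Fintype E] [DecidableEq V] (G : WeightedGraph V E) :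
    Matrix G.Interior G.Interior ℝ :=
  Matrix.of fun u v =>
    if u = v then ∑ e ∈ G.edgesTo u Finset.univ, G.c e
    else - ∑ e ∈ G.edgesTo u {(v : V)}, G.c e

/-- The Dirichlet Green function `Δ⁻¹`, extended by `0` to the boundary. -/
def green {V E : Type*} [Fintype V] [Fintype E] [DecidableEq V] (G : WeightedGraph V E)
    (x y : V) : ℝ :=
  if h : x ∉ G.bdry ∧ y ∉ G.bdry then (G.laplacian)⁻¹ ⟨x, h.1⟩ ⟨y, h.2⟩ else 0

/-- The transfer current `T(xy, uv) = c(uv) (G(x,u) - G(y,u) - G(x,v) + G(y,v))`. -/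
def transferCurrent {V E : Type*} [Fintype V] [Fintype E] [DecidableEq V]
    (G : WeightedGraph V E) (e f : E) : ℝ :=
  G.c f * (G.green (G.src e) (G.src f) - G.green (G.tgt e) (G.src f)
    - G.green (G.src e) (G.tgt f) + G.green (G.tgt e) (G.tgt f))

/-- The minor `det (I - T)_F` with rows and columns indexed by the set `F` of edges. Each edge
occurs once, with its reference orientation. -/
def detCompl {V E : Type*} [Fintype V] [Fintype E] [DecidableEq V] [DecidableEq E]
    (G : WeightedGraph V E) (F : Finset E) : ℝ :=
  (Matrix.of fun e f : F => (1 : Matrix F F ℝ) e f - G.transferCurrent e f).det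

/-! ### The abelian sandpile -/

/-- Every height is less than the degree. -/
def Stable {V E : Type*} [Fintype V] [Fintype E] [DecidableEq V] (G : WeightedGraph V E)
    (η : G.Interior → ℕ) : Prop :=
  ∀ v : G.Interior, η v < G.deg v

/-- `η'` arises from `η` by toppling an unstable vertex `v`, which sends one particle along each
of its edges; particles that reach the boundary are lost. -/
def Topples {V E : Type*} [Fintype V] [Fintype E] [DecidableEq V] (G : WeightedGraph V E)
    (η η' : G.Interior → ℕ) : Prop :=
  ∃ v : G.Interior, G.deg v ≤ η v ∧
    η' = fun u : G.Interior => if u = v then η v - G.deg v else η u + (G.edgesTo v {(u : V)}).card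

/-- `η'` is the stabilization of `η`. -/
def StabilizesTo {V E : Type*} [Fintype V] [Fintype E] [DecidableEq V] (G : WeightedGraph V E)
    (η η' : G.Interior → ℕ) : Prop :=
  Relation.ReflTransGen G.Topples η η' ∧ G.Stable η'

/-- A transition of positive probability of the sandpile Markov chain: add a particle at some
interior vertex, then stabilize. -/
def Step {V E : Type*} [Fintype V] [Fintype E] [DecidableEq V] (G : WeightedGraph V E)
    (η η' : G.Interior → ℕ) : Prop :=
  ∃ v : G.Interior, G.StabilizesTo (η + Pi.single v 1) η'

/-- Recurrent states of the sandpile Markov chain, which is a chain on the finite set of stable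
configurations: the chain can return to `η` from every state that it can reach from `η`. -/
def Recurrent {V E : Type*} [Fintype V] [Fintype E] [DecidableEq V] (G : WeightedGraph V E)
    (η : G.Interior → ℕ) : Prop :=
  G.Stable η ∧
    ∀ η', Relation.ReflTransGen G.Step η η' → Relation.ReflTransGen G.Step η' η

/-- The finite set of recurrent configurations. -/
def recurrentConfigs {V E : Type*} [Fintype V] [Fintype E] [DecidableEq V]
    (G : WeightedGraph V E) : Finset (G.Interior → ℕ) :=
  open Classical in
    (Fintype.piFinset fun v : G.Interior => Finset.range (G.deg v)).filter fun η => G.Recurrent η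

/-- The configuration `η` restricts to `ξ` on `W`. -/
def RestrictsTo {V E : Type*} {G : WeightedGraph V E} (η : G.Interior → ℕ)
    {W : Finset G.Interior} (ξ : W → ℕ) : Prop :=
  ∀ w : W, η w = ξ w

/-- `ξ` is part of a recurrent configuration. -/
def Extendable {V E : Type*} [Fintype V] [Fintype E] [DecidableEq V] (G : WeightedGraph V E)
    {W : Finset G.Interior} (ξ : W → ℕ) : Prop :=
  ∃ η, G.Recurrent η ∧ RestrictsTo η ξ

/-- `ξ` is a minimal subconfiguration on `W`: it is part of a recurrent configuration, and this
fails as soon as one of its heights is decreased. -/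
def IsMinimal {V E : Type*} [Fintype V] [Fintype E] [DecidableEq V] (G : WeightedGraph V E)
    {W : Finset G.Interior} (ξ : W → ℕ) : Prop :=
  G.Extendable ξ ∧ ∀ w : W, ∀ k < ξ w, ¬ G.Extendable (Function.update ξ w k)

/-! ### The burning bijection in which `W` is burnt last -/

/-- Successive sets of burnt vertices. The fire starts with `burnt 0 = ∅`, `burnt 1 = X`; then, at
each step, all interior vertices of `A` burn whose height is at least the number of their edges
to unburnt vertices. -/
def burnt {V E : Type*} [Fintype V] [Fintype E] [DecidableEq V] (G : WeightedGraph V E)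
    (η : G.Interior → ℕ) (A X : Finset V) : ℕ → Finset V
  | 0 => ∅
  | 1 => X
  | k + 2 =>
    open Classical in
      G.burnt η A X (k + 1) ∪ Finset.univ.filter fun v =>
        v ∈ A ∧ ∃ h : v ∉ G.bdry, (G.edgesTo v (G.burnt η A X (k + 1))ᶜ).card ≤ η ⟨v, h⟩

/-- The vertices that are burnt eventually. -/
def allBurnt {V E : Type*} [Fintype V] [Fintype E] [DecidableEq V] (G : WeightedGraph V E)
    (η : G.Interior → ℕ) (A X : Finset V) : Finset V :=
  open Classical in Finset.univ.filter fun v => ∃ k, v ∈ G.burnt η A X k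

/-- The edges selected by a fire. A vertex `v` that burns at step `k + 2` selects one of its edges
to the vertices burnt exactly one step earlier. If `η v` is the number of edges of `v` to
vertices unburnt at that time plus `i`, it is the edge preceded by exactly `i` others of these
edges, in the ordering of the edges around `v` given by the numbering `rank v`. -/
def fireEdges {V E : Type*} [Fintype V] [Fintype E] [DecidableEq V] (G : WeightedGraph V E)
    (rank : G.Interior → E → ℕ) (η : G.Interior → ℕ) (A X : Finset V) : Finset E :=
  open Classical in Finset.univ.filter fun e =>
    ∃ (v : G.Interior) (k : ℕ),
      (v : V) ∈ G.burnt η A X (k + 2) \ G.burnt η A X (k + 1) ∧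
      e ∈ G.edgesTo v (G.burnt η A X (k + 1) \ G.burnt η A X k) ∧
      η v = (G.edgesTo v (G.burnt η A X (k + 1))ᶜ).card +
        ((G.edgesTo v (G.burnt η A X (k + 1) \ G.burnt η A X k)).filter
          fun f => rank v f < rank v e).card

/-- A set of interior vertices as a set of vertices. -/
def toVerts {V E : Type*} {G : WeightedGraph V E} (W : Finset G.Interior) : Finset V :=
  W.map (Function.Embedding.subtype _)

/-- The burning map relative to `W`. First the fire starts at the boundary and is only allowed to
burn vertices outside `W`; when it stops, it is started again from all vertices burnt so far, and
all vertices may burn. The image of `η` is the set of edges selected in the two phases. -/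
def burningMap {V E : Type*} [Fintype V] [Fintype E] [DecidableEq V] [DecidableEq E]
    (G : WeightedGraph V E) (rank : G.Interior → E → ℕ) (W : Finset G.Interior)
    (η : G.Interior → ℕ) : Finset E :=
  G.fireEdges rank η (toVerts W)ᶜ G.bdry ∪
    G.fireEdges rank η Finset.univ (G.allBurnt η (toVerts W)ᶜ G.bdry)

/-- The probability of `η_W = ξ` under the sandpile measure, the pullback under the burning
bijection of the weighted spanning tree measure on the wired graph. -/
def sandpileProb {V E : Type*} [Fintype V] [Fintype E] [DecidableEq V] [DecidableEq E]
    (G : WeightedGraph V E) (rank : G.Interior → E → ℕ) {W : Finset G.Interior}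
    (ξ : W → ℕ) : ℝ :=
  open Classical in
    ∑ η ∈ G.recurrentConfigs.filter (fun η => RestrictsTo η ξ),
      G.wired.weight (G.burningMap rank W η) / G.wired.treeSum

/-! ### The graph `G_W` -/

/-- The graph `G_W`: all vertices outside `W` are wired together. -/
abbrev wiredOff {V E : Type*} [Fintype V] [DecidableEq V] (G : WeightedGraph V E)
    (W : Finset G.Interior) : WeightedGraph (Option {v : V // v ∉ (toVerts W)ᶜ}) E :=
  G.wire (toVerts W)ᶜ

/-- The edges with at least one end in `W`; these are the edges of `G_W` which are not loops. -/
def edgesAt {V E : Type*} [Fintype E] [DecidableEq V] (G : WeightedGraph V E)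
    (W : Finset G.Interior) : Finset E :=
  Finset.univ.filter fun e => G.src e ∈ toVerts W ∨ G.tgt e ∈ toVerts W

end

end WeightedGraph

/-!
By Dhar's criterion the recurrent configurations are the stable ones that the fire burns entirely.
The selected edges point from each vertex to a parent which burns one step earlier, and the same
two-phase fire, run with the rule that a vertex burns once its parent is burnt, recovers the burning
times from the tree alone. Since the heights can be read off from the burning times and the selected
edges, `φ` is a bijection.

If `ξ` is minimal, the first phase burns every vertex outside `W`, as otherwise some height on `W`
could be decreased. The second phase is then a burning bijection for `G_W`, so `η_W = ξ` if and only
if `φ η` meets the edges at `W` exactly in a fixed spanning tree `T₀` of `G_W`.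

By the matrix-tree theorem, `det (I - T)` on a set `F` of edges is the probability that the random
tree avoids `F`. For `F = 𝓔(T)` this means that the tree meets the edges at `W` exactly in `T`. All
spanning trees of `G_W` are completed to wired spanning trees by the same sets of edges, so this
probability is proportional to `weight T`; averaging over `T` gives the second formula.
-/

namespace WeightedGraph

section Edges

variable {V E : Type*} [Fintype E] [DecidableEq V] {G : WeightedGraph V E}

theorem mem_edgesTo {v : V} {X : Finset V} {e : E} :
    e ∈ G.edgesTo v X ↔ ∃ x ∈ X, s(G.src e, G.tgt e) = s(v, x) := by
  simp only [edgesTo, Finset.mem_filter, Finset.mem_univ, true_and, Sym2.eq_iff]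
  aesop

theorem edgesTo_mono (v : V) {X Y : Finset V} (h : X ⊆ Y) : G.edgesTo v X ⊆ G.edgesTo v Y := by
  intro e he
  obtain ⟨x, hx, hex⟩ := mem_edgesTo.1 he
  exact mem_edgesTo.2 ⟨x, h hx, hex⟩

theorem card_edgesTo_mono (v : V) {X Y : Finset V} (h : X ⊆ Y) :
    (G.edgesTo v X).card ≤ (G.edgesTo v Y).card :=
  Finset.card_le_card (edgesTo_mono v h)

@[simp]
theorem edgesTo_empty (v : V) : G.edgesTo v ∅ = ∅ := by
  simp [edgesTo]

theorem edgesTo_singleton_comm (u v : V) : G.edgesTo u {v} = G.edgesTo v {u} := by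
  ext e
  simp [mem_edgesTo, Sym2.eq_swap (a := u)]

theorem edgesTo_singleton_self (hloop : ∀ e, G.src e ≠ G.tgt e) (v : V) :
    G.edgesTo v {v} = ∅ := by
  ext e
  simpa [mem_edgesTo] using fun h h' => hloop e (h.trans h'.symm)

theorem card_edgesTo_union (v : V) {X Y : Finset V} (h : Disjoint X Y) :
    (G.edgesTo v (X ∪ Y)).card = (G.edgesTo v X).card + (G.edgesTo v Y).card := by
  classical
  have hunion : G.edgesTo v (X ∪ Y) = G.edgesTo v X ∪ G.edgesTo v Y := by
    ext e
    simp [mem_edgesTo, or_and_right, exists_or]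
  rw [hunion, Finset.card_union_of_disjoint]
  refine Finset.disjoint_left.2 fun e heX heY => ?_
  obtain ⟨x, hx, hex⟩ := mem_edgesTo.1 heX
  obtain ⟨y, hy, hey⟩ := mem_edgesTo.1 heY
  obtain rfl := Sym2.congr_right.1 (hex.symm.trans hey)
  exact Finset.disjoint_left.1 h hx hy

theorem card_edgesTo_insert (u : V) {v : V} {X : Finset V} (h : v ∉ X) :
    (G.edgesTo u (insert v X)).card = (G.edgesTo u X).card + (G.edgesTo v {u}).card := by
  rw [← Finset.union_singleton, card_edgesTo_union u (Finset.disjoint_singleton_right.2 h),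
    edgesTo_singleton_comm]

variable [Fintype V]

theorem card_edgesTo_add_compl (v : V) (X : Finset V) :
    (G.edgesTo v X).card + (G.edgesTo v Xᶜ).card = G.deg v := by
  rw [← card_edgesTo_union v disjoint_compl_right, Finset.union_compl, deg]

theorem card_edgesTo_compl_add_sdiff (v : V) {X Y : Finset V} (h : X ⊆ Y) :
    (G.edgesTo v Yᶜ).card + (G.edgesTo v (Y \ X)).card = (G.edgesTo v Xᶜ).card := by
  rw [← card_edgesTo_union v (disjoint_compl_left.mono_right Finset.sdiff_subset)]
  congr 2
  grind [Finset.mem_compl]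

theorem card_edgesTo_lt_deg {v : V} {F : Finset V} (h : (G.edgesTo v Fᶜ).Nonempty) :
    (G.edgesTo v F).card < G.deg v := by
  rw [← card_edgesTo_add_compl v F]
  exact Nat.lt_add_of_pos_right h.card_pos

theorem exists_edgesTo_compl_of_walk {x b : V} (w : (G.simple Finset.univ).Walk x b)
    {F : Finset V} (hx : x ∈ F) (hb : b ∉ F) :
    ∃ v ∈ F, v ∈ w.support ∧ (G.edgesTo v Fᶜ).Nonempty := by
  obtain ⟨d, hd, hfst, hsnd⟩ := w.exists_boundary_dart (F : Set V) hx hb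
  obtain ⟨-, e, -, he⟩ := d.adj
  exact ⟨d.fst, hfst, w.dart_fst_mem_support_of_mem_darts hd, e,
    mem_edgesTo.2 ⟨d.snd, by simpa using hsnd, he⟩⟩

theorem exists_edgesTo_compl (hconn : G.IsConn) (hbdry : G.bdry.Nonempty) {F : Finset V}
    (hF : F.Nonempty) (hd : Disjoint F G.bdry) : ∃ v ∈ F, (G.edgesTo v Fᶜ).Nonempty := by
  obtain ⟨x, hx⟩ := hF
  obtain ⟨b, hb⟩ := hbdry
  obtain ⟨w⟩ := hconn.preconnected x b
  obtain ⟨v, hv, -, h⟩ := exists_edgesTo_compl_of_walk w hx (Finset.disjoint_right.1 hd hb)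
  exact ⟨v, hv, h⟩

theorem deg_pos (hconn : G.IsConn) (hbdry : G.bdry.Nonempty) (v : G.Interior) :
    0 < G.deg v := by
  obtain ⟨x, hx, h⟩ := exists_edgesTo_compl hconn hbdry (Finset.singleton_nonempty (v : V))
    (Finset.disjoint_singleton_left.2 v.2)
  rw [Finset.mem_singleton.1 hx] at h
  exact (Nat.zero_le _).trans_lt (card_edgesTo_lt_deg h)

end Edges

end WeightedGraph

open Relation

section Diamond

variable {α : Type*} {r : α → α → Prop}

theorem acc_of_diamond (hr : ∀ ⦃a b c⦄, r a b → r a c → b = c ∨ ∃ d, r b d ∧ r c d) {a b : α}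
    (hab : r a b) (hb : Acc (flip r) b) : Acc (flip r) a := by
  induction hb generalizing a with
  | intro b hb ih =>
    refine ⟨_, fun c hac => ?_⟩
    obtain rfl | ⟨d, hbd, hcd⟩ := hr hab hac
    · exact ⟨_, hb⟩
    · exact ih d hbd hcd

theorem acc_of_reflTransGen_of_diamond
    (hr : ∀ ⦃a b c⦄, r a b → r a c → b = c ∨ ∃ d, r b d ∧ r c d) {a b : α}
    (hab : ReflTransGen r a b) (hb : ∀ c, ¬ r b c) : Acc (flip r) a := by
  induction hab using ReflTransGen.head_induction_on with
  | refl => exact ⟨_, fun c hc => absurd hc (hb c)⟩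
  | head hac _ ih => exact acc_of_diamond hr hac ih

theorem reflTransGen_of_diamond
    (hr : ∀ ⦃a b c⦄, r a b → r a c → b = c ∨ ∃ d, r b d ∧ r c d) {a b c : α}
    (hab : ReflTransGen r a b) (hb : ∀ d, ¬ r b d) (hac : ReflTransGen r a c) :
    ReflTransGen r c b := by
  have hjoin : Join (ReflTransGen r) b c := by
    refine church_rosser (fun x y z hxy hxz => ?_) hab hac
    obtain rfl | ⟨d, hyd, hzd⟩ := hr hxy hxz
    · exact ⟨y, .refl, .refl⟩
    · exact ⟨d, .single hyd, .single hzd⟩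
  obtain ⟨d, hbd, hcd⟩ := hjoin
  obtain rfl | ⟨_, hbe, -⟩ := hbd.cases_head
  · exact hcd
  · exact absurd hbe (hb _)

end Diamond

namespace WeightedGraph

/-! ### Dhar's criterion -/

section Sandpile

variable {V E : Type*} [Fintype E] [DecidableEq V] {G : WeightedGraph V E}
  {η η' ζ : G.Interior → ℕ}

/-- The configuration `η` has no forbidden subconfiguration: every nonempty set of interior
vertices contains a vertex whose height is at least its number of edges within the set. -/
def IsAllowed (G : WeightedGraph V E) (η : G.Interior → ℕ) : Prop :=
  ∀ F : Finset V, F.Nonempty → Disjoint F G.bdry →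
    ∃ v : G.Interior, (v : V) ∈ F ∧ (G.edgesTo v F).card ≤ η v

theorem IsAllowed.mono (h : G.IsAllowed η) (hle : η ≤ η') : G.IsAllowed η' := fun F hF hd => by
  obtain ⟨v, hv, hcard⟩ := h F hF hd
  exact ⟨v, hv, hcard.trans (hle v)⟩

variable [Fintype V]

theorem IsAllowed.topples (hloop : ∀ e, G.src e ≠ G.tgt e) (h : G.IsAllowed η)
    (ht : G.Topples η η') : G.IsAllowed η' := by
  obtain ⟨v, -, rfl⟩ := ht
  intro F hF hd
  by_cases hvF : (v : V) ∈ F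
  · have hcard (u : V) := card_edgesTo_insert (G := G) u (F.notMem_erase (v : V))
    simp only [Finset.insert_erase hvF] at hcard
    rcases (F.erase (v : V)).eq_empty_or_nonempty with hF' | hF'
    · exact ⟨v, hvF, by simp [hcard, hF', edgesTo_singleton_self hloop]⟩
    · obtain ⟨u, hu, hle⟩ := h _ hF' (hd.mono_left (F.erase_subset _))
      have hne : u ≠ v := fun huv => Finset.ne_of_mem_erase hu (congrArg _ huv)
      exact ⟨u, Finset.mem_of_mem_erase hu, by simpa [hcard, hne] using hle⟩
  · obtain ⟨u, hu, hle⟩ := h F hF hd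
    have hne : u ≠ v := by grind
    exact ⟨u, hu, by simpa [hne] using hle.trans (Nat.le_add_right _ _)⟩

theorem IsAllowed.step (hloop : ∀ e, G.src e ≠ G.tgt e) (h : G.IsAllowed η)
    (hs : G.Step η η') : G.IsAllowed η' := by
  obtain ⟨v, hv, -⟩ := hs
  have hadd : G.IsAllowed (η + Pi.single v 1) := h.mono (by simp)
  induction hv with
  | refl => exact hadd
  | tail _ ht ih => exact ih.topples hloop ht

theorem isAllowed_deg_sub_one (hconn : G.IsConn) (hbdry : G.bdry.Nonempty) :
    G.IsAllowed fun v => G.deg v - 1 := fun F hF hd => by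
  obtain ⟨v, hv, h⟩ := exists_edgesTo_compl hconn hbdry hF hd
  exact ⟨⟨v, Finset.disjoint_left.1 hd hv⟩, hv, Nat.le_sub_one_of_lt (card_edgesTo_lt_deg h)⟩

theorem stable_iff_forall_not_topples : G.Stable η ↔ ∀ η', ¬ G.Topples η η' := by
  refine ⟨fun h η' ⟨v, hv, _⟩ => hv.not_gt (h v), fun h v => ?_⟩
  by_contra! hv
  exact h _ ⟨v, hv, rfl⟩

theorem Topples.diamond ⦃η η₁ η₂ : G.Interior → ℕ⦄ (h₁ : G.Topples η η₁) (h₂ : G.Topples η η₂) :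
    η₁ = η₂ ∨ ∃ ζ, G.Topples η₁ ζ ∧ G.Topples η₂ ζ := by
  obtain ⟨v, hv, rfl⟩ := h₁
  obtain ⟨w, hw, rfl⟩ := h₂
  by_cases hvw : v = w
  · exact Or.inl (by rw [hvw])
  · refine Or.inr ⟨_, ⟨w, ?_, rfl⟩, v, ?_, ?_⟩
    · simp only [Ne.symm hvw, if_false]
      omega
    · simp only [hvw, if_false]
      omega
    · funext u
      grind

theorem Topples.add_right (h : G.Topples η η') (ζ : G.Interior → ℕ) :
    G.Topples (η + ζ) (η' + ζ) := by
  obtain ⟨v, hv, rfl⟩ := h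
  refine ⟨v, hv.trans (Nat.le_add_right _ _), ?_⟩
  funext u
  simp only [Pi.add_apply]
  grind

theorem reflTransGen_topples_add_right (h : ReflTransGen G.Topples η η')
    (ζ : G.Interior → ℕ) : ReflTransGen G.Topples (η + ζ) (η' + ζ) :=
  h.lift (· + ζ) fun _ _ ht => ht.add_right ζ

theorem StabilizesTo.reflTransGen (h : G.StabilizesTo η ζ) (h' : ReflTransGen G.Topples η η') :
    ReflTransGen G.Topples η' ζ :=
  reflTransGen_of_diamond Topples.diamond h.1 (stable_iff_forall_not_topples.1 h.2) h'

theorem StabilizesTo.exists_of_add {β : G.Interior → ℕ} (h : G.StabilizesTo (η + β) ζ) :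
    ∃ η', G.StabilizesTo η η' ∧ G.StabilizesTo (η' + β) ζ := by
  have hacc : Acc (flip G.Topples) (η + β) := acc_of_reflTransGen_of_diamond Topples.diamond
    h.1 (stable_iff_forall_not_topples.1 h.2)
  suffices ∃ η', G.StabilizesTo η η' by
    obtain ⟨η', hη'⟩ := this
    exact ⟨η', hη', h.reflTransGen (reflTransGen_topples_add_right hη'.1 β), h.2⟩
  generalize hσ : η + β = σ at hacc
  clear h
  induction hacc generalizing η with
  | intro σ _ ih =>
    subst hσ
    by_cases hη : G.Stable η
    · exact ⟨η, .refl, hη⟩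
    · simp only [stable_iff_forall_not_topples, not_forall, not_not] at hη
      obtain ⟨η₁, hη₁⟩ := hη
      obtain ⟨η', hη'⟩ := ih _ (hη₁.add_right β) rfl
      exact ⟨η', .head hη₁ hη'.1, hη'.2⟩

theorem StabilizesTo.reflTransGen_step {β : G.Interior → ℕ} (hη : G.Stable η)
    (h : G.StabilizesTo (η + β) ζ) : ReflTransGen G.Step η ζ := by
  induction hn : ∑ v, β v generalizing η β with
  | zero =>
    obtain rfl : β = 0 := funext fun v => Finset.sum_eq_zero_iff.1 hn v (Finset.mem_univ v)
    rw [add_zero] at h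
    obtain rfl | ⟨_, ht, -⟩ := h.1.cases_head
    · exact .refl
    · exact absurd ht (stable_iff_forall_not_topples.1 hη _)
  | succ n ih =>
    obtain ⟨v, -, hv⟩ := Finset.exists_ne_zero_of_sum_ne_zero (hn.trans_ne n.succ_ne_zero)
    have hle : Pi.single v 1 ≤ β := by
      simpa [Pi.single, update_le_iff] using Nat.one_le_iff_ne_zero.2 hv
    obtain ⟨β', rfl⟩ := exists_add_of_le hle
    rw [← add_assoc] at h
    obtain ⟨η', hη', hζ⟩ := h.exists_of_add
    refine .head ⟨v, hη'⟩ (ih hη'.2 hζ ?_)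
    simp only [Pi.add_apply, Finset.sum_add_distrib, Finset.sum_pi_single', Finset.mem_univ,
      if_true] at hn
    omega

theorem Stable.le_deg_sub_one (hη : G.Stable η) : η ≤ fun v : G.Interior => G.deg v - 1 :=
  fun v => Nat.le_sub_one_of_lt (hη v)

theorem Stable.reflTransGen_step_deg_sub_one (hη : G.Stable η)
    (hdeg : ∀ v : G.Interior, 0 < G.deg v) :
    ReflTransGen G.Step η fun v : G.Interior => G.deg v - 1 := by
  obtain ⟨β, hβ⟩ := exists_add_of_le hη.le_deg_sub_one
  exact StabilizesTo.reflTransGen_step hη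
    ⟨by rw [← hβ], fun v => Nat.sub_one_lt_of_lt (hdeg v)⟩

theorem Recurrent.isAllowed (hloop : ∀ e, G.src e ≠ G.tgt e) (hconn : G.IsConn)
    (hbdry : G.bdry.Nonempty) (h : G.Recurrent η) : G.IsAllowed η := by
  have hreach := h.2 _ (h.1.reflTransGen_step_deg_sub_one (deg_pos hconn hbdry))
  clear h
  induction hreach with
  | refl => exact isAllowed_deg_sub_one hconn hbdry
  | tail _ hs ih => exact ih.step hloop hs

-- Dhar's burning test: `ζ` arises when every vertex of `B` sends one particle along each of its
-- edges, so toppling the remaining vertices, in the order in which they burn, restores `η`.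
theorem IsAllowed.reflTransGen_of_add_eq (hloop : ∀ e, G.src e ≠ G.tgt e) (h : G.IsAllowed η)
    {B : Finset V} (hB : G.bdry ⊆ B)
    (hζ : ∀ v : G.Interior,
      ζ v + (if (v : V) ∈ B then G.deg v else 0) = η v + (G.edgesTo v B).card) :
    ReflTransGen G.Topples ζ η := by
  induction hn : Bᶜ.card generalizing B ζ with
  | zero =>
    obtain rfl : B = Finset.univ := by simpa using hn
    obtain rfl : ζ = η := funext fun v => by simpa [deg] using hζ v
    exact .refl
  | succ n ih =>
    obtain ⟨v, hv, hle⟩ := h Bᶜ (Finset.card_pos.1 (by omega)) (disjoint_compl_left.mono_right hB)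
    have hvB : (v : V) ∉ B := Finset.mem_compl.1 hv
    have hdeg := card_edgesTo_add_compl (G := G) (v : V) B
    have hζv : ζ v = η v + (G.edgesTo v B).card := by simpa [hvB] using hζ v
    refine .head ⟨v, by omega, rfl⟩
      (ih (B := insert (v : V) B) (hB.trans (Finset.subset_insert _ _)) (fun u => ?_) ?_)
    · have hcard := card_edgesTo_insert (G := G) (u : V) hvB
      have hself := congrArg Finset.card (edgesTo_singleton_self hloop (v : V))
      rw [Finset.card_empty] at hself
      have hζu := hζ u
      by_cases huv : u = v
      · subst huv
        simp only [if_true, Finset.mem_insert_self]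
        omega
      · simp only [huv, if_false, Finset.mem_insert, Subtype.coe_inj, false_or]
        omega
    · rw [Finset.compl_insert, Finset.card_erase_of_mem hv, hn, Nat.add_sub_cancel]

/-- The additive monoid of the configurations `β` such that `η + β` can topple back to `η`. -/
def absorbed (G : WeightedGraph V E) (η : G.Interior → ℕ) : AddSubmonoid (G.Interior → ℕ) where
  carrier := {β | ReflTransGen G.Topples (η + β) η}
  zero_mem' := by
    rw [Set.mem_ofPred_eq, add_zero]
  add_mem' {β β'} h h' := by
    rw [Set.mem_ofPred_eq, ← add_assoc]
    exact (reflTransGen_topples_add_right h β').trans h'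

theorem mem_absorbed {β : G.Interior → ℕ} :
    β ∈ G.absorbed η ↔ ReflTransGen G.Topples (η + β) η :=
  Iff.rfl

theorem Stable.topples_mem_absorbed (hη : G.Stable η) {β β' : G.Interior → ℕ}
    (hβ : β ∈ G.absorbed η) (h : G.Topples β β') : β' ∈ G.absorbed η := by
  have h' : G.Topples (η + β) (η + β') := by
    simpa only [add_comm η] using h.add_right η
  exact StabilizesTo.reflTransGen ⟨hβ, hη⟩ (.single h')

theorem IsAllowed.card_edgesTo_bdry_mem_absorbed (hloop : ∀ e, G.src e ≠ G.tgt e)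
    (h : G.IsAllowed η) : (fun v : G.Interior => (G.edgesTo v G.bdry).card) ∈ G.absorbed η :=
  h.reflTransGen_of_add_eq hloop subset_rfl fun v => by simp [v.2]

-- The absorbed particles flood the graph from the boundary: each unit of height can be multiplied
-- until the vertex topples onto its neighbours.
theorem IsAllowed.exists_mem_absorbed_pos (hloop : ∀ e, G.src e ≠ G.tgt e) (hconn : G.IsConn)
    (hbdry : G.bdry.Nonempty) (h : G.IsAllowed η) (hη : G.Stable η) (v : G.Interior) :
    ∃ β ∈ G.absorbed η, 0 < β v := by
  classical
  let dry : Finset V := Finset.univ.filter fun u =>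
    ∃ hu : u ∉ G.bdry, ∀ β ∈ G.absorbed η, β ⟨u, hu⟩ = 0
  suffices dry = ∅ by
    by_contra! hv
    exact (this.symm ▸ Finset.notMem_empty (v : V))
      (Finset.mem_filter.2 ⟨Finset.mem_univ _, v.2, fun β hβ => by simpa using hv β hβ⟩)
  by_contra hne
  obtain ⟨u, hu, e, he⟩ := exists_edgesTo_compl hconn hbdry (Finset.nonempty_iff_ne_empty.2 hne)
    (Finset.disjoint_left.2 fun u hu => (Finset.mem_filter.1 hu).2.1)
  obtain ⟨hu', hzero⟩ := (Finset.mem_filter.1 hu).2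
  obtain ⟨w, hw, hew⟩ := mem_edgesTo.1 he
  by_cases hwb : w ∈ G.bdry
  · exact (Finset.card_pos.2 ⟨e, mem_edgesTo.2 ⟨w, hwb, hew⟩⟩).ne'
      (hzero _ (h.card_edgesTo_bdry_mem_absorbed hloop))
  · obtain ⟨β, hβ, hβw⟩ : ∃ β ∈ G.absorbed η, β ⟨w, hwb⟩ ≠ 0 := by
      simpa [dry, hwb] using hw
    have hne : (⟨u, hu'⟩ : G.Interior) ≠ ⟨w, hwb⟩ := by
      rintro ⟨⟩
      exact Finset.mem_compl.1 hw hu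
    have htopple : G.Topples (G.deg w • β) _ := ⟨⟨w, hwb⟩, by
      simpa using Nat.le_mul_of_pos_right _ (Nat.pos_of_ne_zero hβw), rfl⟩
    have hzero' := hzero _ (hη.topples_mem_absorbed (nsmul_mem hβ _) htopple)
    simp only [hne, if_false, Nat.add_eq_zero_iff] at hzero'
    exact (Finset.card_pos.2 ⟨e, mem_edgesTo.2 ⟨u, Finset.mem_singleton_self u, by
      rw [hew, Sym2.eq_swap]⟩⟩).ne' hzero'.2

theorem IsAllowed.recurrent (hloop : ∀ e, G.src e ≠ G.tgt e) (hconn : G.IsConn)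
    (hbdry : G.bdry.Nonempty) (h : G.IsAllowed η) (hη : G.Stable η) : G.Recurrent η := by
  refine ⟨hη, fun η' hreach => ?_⟩
  have hη' : G.Stable η' := by
    obtain rfl | ⟨_, -, v, hv⟩ := hreach.cases_tail
    · exact hη
    · exact hv.2
  have hdeg := deg_pos hconn hbdry
  refine (hη'.reflTransGen_step_deg_sub_one hdeg).trans ?_
  choose β hβ hβpos using h.exists_mem_absorbed_pos hloop hconn hbdry hη
  let σ : G.Interior → ℕ := ∑ v : G.Interior, G.deg v • β v
  have hσ : σ ∈ G.absorbed η := sum_mem fun v _ => nsmul_mem (hβ v) _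
  have hle : (fun v : G.Interior => G.deg v - 1) ≤ η + σ := fun v => calc
    G.deg v - 1 ≤ G.deg v * β v v := (Nat.sub_le _ _).trans (Nat.le_mul_of_pos_right _ (hβpos v))
    _ ≤ ∑ w : G.Interior, G.deg w * β w v :=
      Finset.single_le_sum (f := fun w : G.Interior => G.deg w * β w v)
        (fun _ _ => Nat.zero_le _) (Finset.mem_univ v)
    _ ≤ (η + σ) v := by simp [σ, Finset.sum_apply]
  obtain ⟨γ, hγ⟩ := exists_add_of_le hle
  exact StabilizesTo.reflTransGen_step (fun v => Nat.sub_one_lt_of_lt (hdeg v))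
    ⟨hγ ▸ mem_absorbed.1 hσ, hη⟩

theorem recurrent_iff (hloop : ∀ e, G.src e ≠ G.tgt e) (hconn : G.IsConn)
    (hbdry : G.bdry.Nonempty) : G.Recurrent η ↔ G.Stable η ∧ G.IsAllowed η :=
  ⟨fun h => ⟨h.1, h.isAllowed hloop hconn hbdry⟩, fun h => h.2.recurrent hloop hconn hbdry h.1⟩

theorem mem_recurrentConfigs : η ∈ G.recurrentConfigs ↔ G.Recurrent η := by
  simp only [recurrentConfigs, Finset.mem_filter, Fintype.mem_piFinset, Finset.mem_range,
    and_iff_right_iff_imp]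
  exact fun h => h.1

end Sandpile

end WeightedGraph

section RestrictOff

variable {V : Type*} {S U : Finset V}

/-- The restriction to the complement of `U` of a map on the complement of `S`. -/
def restrictOff {α : Type*} (hSU : S ⊆ U) (f : {v // v ∉ S} → α) : {v // v ∉ U} → α :=
  fun v => f ⟨v, fun hv => v.2 (hSU hv)⟩

/-- The map that agrees with `f` on `U` and with `g` outside `U`. -/
def glueOff [DecidableEq V] {α : Type*} (f : {v // v ∉ S} → α) (g : {v // v ∉ U} → α) :
    {v // v ∉ S} → α :=
  fun v => if h : (v : V) ∈ U then f v else g ⟨v, h⟩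

end RestrictOff

/-! ### Two-phase fires -/

section Fire

variable {V : Type*} [Fintype V] [DecidableEq V] {S A X U F : Finset V}
  {R R' : {v // v ∉ S} → Finset V → Prop} {v : {v // v ∉ S}} {o c : Finset V} {k : ℕ}

/-- The successive sets of burnt vertices of a fire that starts from `X` at time `1` and spreads
within `A`: the vertex `v` catches fire as soon as `R v B` holds for the set `B` of vertices burnt
so far. The vertices of `S` do not obey any rule; they only burn if they are in `X`. The indices
are those of `WeightedGraph.burnt`. -/
noncomputable def fire (R : {v // v ∉ S} → Finset V → Prop) (A X : Finset V) : ℕ → Finset V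
  | 0 => ∅
  | 1 => X
  | k + 2 =>
    open Classical in
      fire R A X (k + 1) ∪ Finset.univ.filter fun v =>
        v ∈ A ∧ ∃ h : v ∉ S, R ⟨v, h⟩ (fire R A X (k + 1))

/-- The vertices that a fire burns eventually. -/
noncomputable def burntOut (R : {v // v ∉ S} → Finset V → Prop) (A X : Finset V) : Finset V :=
  open Classical in Finset.univ.filter fun v => ∃ k, v ∈ fire R A X k

/-- The vertex `v` burns in the fire `fire R A X`, just after the vertices of `c \ o`. -/
def BurnsAfter (R : {v // v ∉ S} → Finset V → Prop) (A X : Finset V) (v : V)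
    (o c : Finset V) : Prop :=
  ∃ k, v ∈ fire R A X (k + 2) \ fire R A X (k + 1) ∧ o = fire R A X k ∧ c = fire R A X (k + 1)

theorem mem_fire_add_two_iff_exists {v : V} :
    v ∈ fire R A X (k + 2) ↔
      v ∈ fire R A X (k + 1) ∨ v ∈ A ∧ ∃ h : v ∉ S, R ⟨v, h⟩ (fire R A X (k + 1)) := by
  simp [fire]

theorem mem_fire_add_two :
    (v : V) ∈ fire R A X (k + 2) ↔
      (v : V) ∈ fire R A X (k + 1) ∨ (v : V) ∈ A ∧ R v (fire R A X (k + 1)) := by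
  simp [mem_fire_add_two_iff_exists, v.2]

theorem fire_mono : Monotone (fire R A X) :=
  monotone_nat_of_le_succ fun k => by
    cases k with
    | zero => exact Finset.empty_subset _
    | succ k => exact Finset.subset_union_left

theorem mem_burntOut {v : V} : v ∈ burntOut R A X ↔ ∃ k, v ∈ fire R A X k := by
  simp [burntOut]

theorem fire_subset_burntOut (k : ℕ) : fire R A X k ⊆ burntOut R A X :=
  fun _ hv => mem_burntOut.2 ⟨k, hv⟩

theorem subset_burntOut : X ⊆ burntOut R A X := fire_subset_burntOut 1

theorem exists_fire_eq_burntOut : ∃ k, fire R A X (k + 1) = burntOut R A X := by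
  choose t ht using fun v : burntOut R A X => mem_burntOut.1 v.2
  refine ⟨Finset.univ.sup t, (fire_subset_burntOut _).antisymm fun v hv => ?_⟩
  exact fire_mono ((Finset.le_sup (Finset.mem_univ ⟨v, hv⟩)).trans (Nat.le_succ _)) (ht ⟨v, hv⟩)

theorem mem_burntOut_of_rule (hA : (v : V) ∈ A) (hv : R v (burntOut R A X)) :
    (v : V) ∈ burntOut R A X := by
  obtain ⟨k, hk⟩ := exists_fire_eq_burntOut (R := R) (A := A) (X := X)
  rw [← hk] at hv
  exact fire_subset_burntOut (k + 2) (mem_fire_add_two.2 (Or.inr ⟨hA, hv⟩))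

theorem burntOut_subset (hX : X ⊆ A) : burntOut R A X ⊆ A := by
  intro v hv
  obtain ⟨k, hk⟩ := mem_burntOut.1 hv
  induction k using Nat.twoStepInduction with
  | zero => exact absurd hk (Finset.notMem_empty v)
  | one => exact hX hk
  | more k _ ih =>
    obtain hk | hk := mem_fire_add_two_iff_exists.1 hk
    · exact ih hk
    · exact hk.1

theorem fire_congr (h : ∀ k, ∀ v : {v // v ∉ S}, (v : V) ∈ A → (v : V) ∉ fire R A X (k + 1) →
    (R v (fire R A X (k + 1)) ↔ R' v (fire R A X (k + 1)))) :
    fire R' A X = fire R A X := by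
  funext k
  induction k using Nat.twoStepInduction with
  | zero => rfl
  | one => rfl
  | more k _ ih =>
    ext v
    rw [mem_fire_add_two_iff_exists, mem_fire_add_two_iff_exists, ih]
    refine or_congr_right' fun hv => and_congr_right fun hA => exists_congr fun hS => ?_
    exact (h k ⟨v, hS⟩ hA hv).symm

theorem burntOut_congr (h : fire R' A X = fire R A X) : burntOut R' A X = burntOut R A X := by
  ext v
  rw [mem_burntOut, mem_burntOut, h]

theorem fire_restrictOff (hSU : S ⊆ U) (hX : U ⊆ X) :
    fire (restrictOff hSU R) A X = fire R A X := by
  funext k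
  induction k using Nat.twoStepInduction with
  | zero => rfl
  | one => rfl
  | more k _ ih =>
    ext v
    rw [mem_fire_add_two_iff_exists, mem_fire_add_two_iff_exists, ih]
    refine or_congr_right' fun hv => and_congr_right fun _ => ?_
    have hvU : v ∉ U := fun hvU => hv (fire_mono (Nat.le_add_left 1 k) (hX hvU))
    exact ⟨fun ⟨_, hR⟩ => ⟨_, hR⟩, fun ⟨_, hR⟩ => ⟨hvU, hR⟩⟩

theorem BurnsAfter.mem_burntOut {v : V} (h : BurnsAfter R A X v o c) : v ∈ burntOut R A X := by
  obtain ⟨k, hv, -, -⟩ := h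
  exact fire_subset_burntOut _ (Finset.mem_sdiff.1 hv).1

theorem BurnsAfter.notMem_start {v : V} (h : BurnsAfter R A X v o c) : v ∉ X := by
  obtain ⟨k, hv, -, -⟩ := h
  exact fun hX => (Finset.mem_sdiff.1 hv).2 (fire_mono (Nat.le_add_left 1 k) hX)

theorem BurnsAfter.notMem {v : V} (h : BurnsAfter R A X v o c) : v ∉ c := by
  obtain ⟨k, hv, rfl, rfl⟩ := h
  exact (Finset.mem_sdiff.1 hv).2

theorem BurnsAfter.subset {v : V} (h : BurnsAfter R A X v o c) : o ⊆ c := by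
  obtain ⟨k, -, rfl, rfl⟩ := h
  exact fire_mono k.le_succ

theorem BurnsAfter.subset_burntOut {v : V} (h : BurnsAfter R A X v o c) :
    c ⊆ burntOut R A X := by
  obtain ⟨k, -, -, rfl⟩ := h
  exact fire_subset_burntOut _

theorem BurnsAfter.start_subset {v : V} (h : BurnsAfter R A X v o c) : X ⊆ c := by
  obtain ⟨k, -, -, rfl⟩ := h
  exact fire_mono (Nat.le_add_left 1 k)

theorem BurnsAfter.subset_of_mem {v w : V} {o' c' : Finset V} (h : BurnsAfter R A X v o c)
    (h' : BurnsAfter R A X w o' c') (hw : w ∈ c) : c' ⊆ c := by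
  obtain ⟨k, -, -, rfl⟩ := h
  obtain ⟨l, hl, -, rfl⟩ := h'
  exact fire_mono (Nat.le_of_not_le fun hle => (Finset.mem_sdiff.1 hl).2 (fire_mono hle hw))

theorem BurnsAfter.rule (h : BurnsAfter R A X v o c) : R v c := by
  obtain ⟨k, hv, -, rfl⟩ := h
  rw [Finset.mem_sdiff, mem_fire_add_two] at hv
  exact (hv.1.resolve_left hv.2).2

theorem BurnsAfter.not_rule (hempty : ¬ R v ∅) (h : BurnsAfter R A X v o c) : ¬ R v o := by
  obtain ⟨k, hv, rfl, -⟩ := h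
  cases k with
  | zero => exact hempty
  | succ k =>
    rw [Finset.mem_sdiff, mem_fire_add_two, mem_fire_add_two] at hv
    tauto

theorem BurnsAfter.eq {v : V} {o' c' : Finset V} (h : BurnsAfter R A X v o c)
    (h' : BurnsAfter R A X v o' c') : o = o' ∧ c = c' := by
  obtain ⟨k, hk, rfl, rfl⟩ := h
  obtain ⟨l, hl, rfl, rfl⟩ := h'
  rw [Finset.mem_sdiff] at hk hl
  have hkl : l + 1 < k + 2 := Nat.lt_of_not_le fun hle => hl.2 (fire_mono hle hk.1)
  have hlk : k + 1 < l + 2 := Nat.lt_of_not_le fun hle => hk.2 (fire_mono hle hl.1)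
  obtain rfl : k = l := by omega
  exact ⟨rfl, rfl⟩

theorem exists_burnsAfter (hX : Disjoint F X) (hF : ¬ Disjoint F (burntOut R A X)) :
    ∃ v ∈ F, ∃ o c, BurnsAfter R A X v o c ∧ Disjoint F c := by
  classical
  have hex : ∃ k, ¬ Disjoint F (fire R A X k) := by
    obtain ⟨v, hvF, hv⟩ := Finset.not_disjoint_iff.1 hF
    obtain ⟨k, hk⟩ := mem_burntOut.1 hv
    exact ⟨k, Finset.not_disjoint_iff.2 ⟨v, hvF, hk⟩⟩
  obtain ⟨k, hk, hmin⟩ : ∃ k, ¬ Disjoint F (fire R A X k) ∧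
      ∀ l < k, Disjoint F (fire R A X l) :=
    ⟨_, Nat.find_spec hex, fun l hl => not_not.1 (Nat.find_min hex hl)⟩
  match k with
  | 0 => exact absurd (Finset.disjoint_empty_right F) hk
  | 1 => exact absurd hX hk
  | k + 2 =>
    obtain ⟨v, hvF, hv⟩ := Finset.not_disjoint_iff.1 hk
    have hd := hmin (k + 1) (Nat.lt_succ_self _)
    exact ⟨v, hvF, _, _, ⟨k, Finset.mem_sdiff.2 ⟨hv, Finset.disjoint_left.1 hd hvF⟩, rfl, rfl⟩,
      hd⟩

/-- A rule under which every fire that starts from a superset of `S` and may spread everywhere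
burns all vertices, and under which a vertex needs some burnt vertex to catch fire. -/
structure IsIgnition (R : {v // v ∉ S} → Finset V → Prop) : Prop where
  mono : ∀ v ⦃B C : Finset V⦄, B ⊆ C → R v B → R v C
  not_empty : ∀ v, ¬ R v ∅
  exists_mem : ∀ F : Finset V, F.Nonempty → Disjoint F S →
    ∃ v : {v // v ∉ S}, (v : V) ∈ F ∧ R v Fᶜ

theorem BurnsAfter.fire_subset (hmono : ∀ ⦃B C : Finset V⦄, B ⊆ C → R v B → R v C)
    (h : BurnsAfter R A X v o c) (hk : ¬ R v (fire R A X (k + 1))) : fire R A X (k + 1) ⊆ o := by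
  have hc := h.rule
  obtain ⟨l, -, rfl, rfl⟩ := h
  refine fire_mono (Nat.lt_of_not_le fun hle => hk (hmono (fire_mono ?_) hc))
  omega

theorem IsIgnition.burntOut_univ (hR : IsIgnition R) (hX : S ⊆ X) :
    burntOut R Finset.univ X = Finset.univ := by
  by_contra hne
  have hd : Disjoint (burntOut R Finset.univ X)ᶜ S :=
    disjoint_compl_left.mono_right (hX.trans subset_burntOut)
  have hF : (burntOut R Finset.univ X)ᶜ.Nonempty := by
    rwa [Finset.nonempty_iff_ne_empty, Ne, Finset.compl_eq_empty_iff]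
  obtain ⟨v, hv, hRv⟩ := hR.exists_mem _ hF hd
  rw [compl_compl] at hRv
  exact Finset.mem_compl.1 hv (mem_burntOut_of_rule (Finset.mem_univ _) hRv)

theorem IsIgnition.restrict (hR : IsIgnition R) (hSU : S ⊆ U) : IsIgnition (restrictOff hSU R) where
  mono _ := hR.mono _
  not_empty _ := hR.not_empty _
  exists_mem F hF hd := by
    obtain ⟨v, hv, hRv⟩ := hR.exists_mem F hF (hd.mono_right hSU)
    exact ⟨⟨v, Finset.disjoint_left.1 hd hv⟩, hv, hRv⟩

/-- The vertex `v` burns just after the vertices of `c \ o` in the two-phase fire, which is first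
confined to `U` and, after it has stopped, restarts from all burnt vertices without restriction. -/
def Stage (R : {v // v ∉ S} → Finset V → Prop) (U : Finset V) (v : V) (o c : Finset V) : Prop :=
  BurnsAfter R U S v o c ∨ BurnsAfter R Finset.univ (burntOut R U S) v o c

theorem Stage.subset {v : V} (h : Stage R U v o c) : o ⊆ c := h.elim (·.subset) (·.subset)

theorem Stage.notMem {v : V} (h : Stage R U v o c) : v ∉ c := h.elim (·.notMem) (·.notMem)

theorem Stage.rule (h : Stage R U v o c) : R v c := h.elim (·.rule) (·.rule)

theorem Stage.not_rule (hempty : ¬ R v ∅) (h : Stage R U v o c) : ¬ R v o :=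
  h.elim (·.not_rule hempty) (·.not_rule hempty)

theorem Stage.notMem_start {v : V} (h : Stage R U v o c) : v ∉ S :=
  h.elim (·.notMem_start) fun h hv => h.notMem_start (subset_burntOut hv)

theorem Stage.eq {v : V} {o' c' : Finset V} (h : Stage R U v o c) (h' : Stage R U v o' c') :
    o = o' ∧ c = c' := by
  rcases h with h | h <;> rcases h' with h' | h'
  · exact h.eq h'
  · exact absurd h.mem_burntOut h'.notMem_start
  · exact absurd h'.mem_burntOut h.notMem_start
  · exact h.eq h'

theorem Stage.subset_of_mem {v w : V} {o' c' : Finset V} (h : Stage R U v o c)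
    (h' : Stage R U w o' c') (hw : w ∈ c) : c' ⊆ c := by
  rcases h with h | h <;> rcases h' with h' | h'
  · exact h.subset_of_mem h' hw
  · exact absurd (h.subset_burntOut hw) h'.notMem_start
  · exact h'.subset_burntOut.trans h.start_subset
  · exact h.subset_of_mem h' hw

theorem Stage.of_restrictOff (hSU : S ⊆ U) (hU : burntOut R U S = U) {v : {v // v ∉ U}}
    (h : Stage (restrictOff hSU R) U v o c) : Stage R U v o c := by
  obtain h | h := h
  · exact absurd (burntOut_subset subset_rfl h.mem_burntOut) v.2
  · rw [(burntOut_subset subset_rfl).antisymm subset_burntOut] at h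
    rw [Stage, hU]
    simpa only [BurnsAfter, fire_restrictOff hSU subset_rfl] using Or.inr h

theorem IsIgnition.exists_stage_disjoint (hR : IsIgnition R) (U : Finset V) (hF : F.Nonempty)
    (hd : Disjoint F S) : ∃ v : {v // v ∉ S}, (v : V) ∈ F ∧ ∃ o c,
      Stage R U v o c ∧ Disjoint F c := by
  suffices ∃ v ∈ F, ∃ o c, Stage R U v o c ∧ Disjoint F c by
    obtain ⟨v, hv, h⟩ := this
    exact ⟨⟨v, Finset.disjoint_left.1 hd hv⟩, hv, h⟩
  by_cases hY : Disjoint F (burntOut R U S)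
  · have hall : ¬ Disjoint F (burntOut R Finset.univ (burntOut R U S)) := by
      rw [hR.burntOut_univ subset_burntOut]
      exact fun h => hF.ne_empty (disjoint_top.1 h)
    obtain ⟨v, hv, o, c, h, hc⟩ := exists_burnsAfter hY hall
    exact ⟨v, hv, o, c, Or.inr h, hc⟩
  · obtain ⟨v, hv, o, c, h, hc⟩ := exists_burnsAfter hd hY
    exact ⟨v, hv, o, c, Or.inl h, hc⟩

theorem IsIgnition.exists_stage (hR : IsIgnition R) (U : Finset V) (v : {v // v ∉ S}) :
    ∃ o c, Stage R U v o c := by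
  obtain ⟨w, hw, o, c, h, -⟩ := hR.exists_stage_disjoint U (Finset.singleton_nonempty (v : V))
    (Finset.disjoint_singleton_left.2 v.2)
  exact ⟨o, c, Finset.mem_singleton.1 hw ▸ h⟩

theorem Stage.burntOut_subset (hmono : ∀ ⦃B C : Finset V⦄, B ⊆ C → R v B → R v C)
    (h : Stage R U v o c) (hU : (v : V) ∈ U) (hv : (v : V) ∉ burntOut R U S) :
    burntOut R U S ⊆ o := by
  obtain h | h := h
  · exact absurd h.mem_burntOut hv
  · exact h.fire_subset (k := 0) hmono fun hRv => hv (mem_burntOut_of_rule hU hRv)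

theorem IsIgnition.fire_eq (hR : IsIgnition R)
    (hR' : ∀ v ⦃B C : Finset V⦄, B ⊆ C → R' v B → R' v C)
    (h : ∀ (v : {v // v ∉ S}) o c, Stage R U v o c → R' v c ∧ ¬ R' v o) :
    fire R' U S = fire R U S ∧
      fire R' Finset.univ (burntOut R U S) = fire R Finset.univ (burntOut R U S) := by
  refine ⟨fire_congr fun k v hU hv => ⟨fun hRv => ?_, ?_⟩,
    fire_congr fun k v hU hv => ⟨fun hRv => ?_, ?_⟩⟩
  · have hnew : (v : V) ∈ fire R U S (k + 2) := mem_fire_add_two.2 (Or.inr ⟨hU, hRv⟩)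
    exact (h v _ _ (Or.inl ⟨k, Finset.mem_sdiff.2 ⟨hnew, hv⟩, rfl, rfl⟩)).1
  · contrapose!
    intro hRv
    obtain ⟨o, c, hs⟩ := hR.exists_stage U v
    refine fun hRv' => (h v o c hs).2 (hR' v ?_ hRv')
    obtain hb | hb := id hs
    · exact hb.fire_subset (hR.mono v) hRv
    · exact (fire_subset_burntOut _).trans (hs.burntOut_subset (hR.mono v) hU hb.notMem_start)
  · have hnew : (v : V) ∈ fire R Finset.univ (burntOut R U S) (k + 2) :=
      mem_fire_add_two.2 (Or.inr ⟨hU, hRv⟩)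
    exact (h v _ _ (Or.inr ⟨k, Finset.mem_sdiff.2 ⟨hnew, hv⟩, rfl, rfl⟩)).1
  · contrapose!
    intro hRv
    obtain ⟨o, c, hb⟩ : ∃ o c, BurnsAfter R Finset.univ (burntOut R U S) v o c := by
      obtain ⟨o, c, hs | hs⟩ := hR.exists_stage U v
      · exact absurd (fire_mono (Nat.le_add_left 1 k) hs.mem_burntOut) hv
      · exact ⟨o, c, hs⟩
    exact fun hRv' => (h v o c (Or.inr hb)).2 (hR' v (hb.fire_subset (hR.mono v) hRv) hRv')

theorem IsIgnition.stage_iff (hR : IsIgnition R)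
    (hR' : ∀ v ⦃B C : Finset V⦄, B ⊆ C → R' v B → R' v C)
    (h : ∀ (v : {v // v ∉ S}) o c, Stage R U v o c → R' v c ∧ ¬ R' v o) {v : V} :
    Stage R' U v o c ↔ Stage R U v o c := by
  obtain ⟨h₁, h₂⟩ := hR.fire_eq hR' h
  simp only [Stage, BurnsAfter, burntOut_congr h₁, h₁, h₂]

theorem IsIgnition.of_stage (hR : IsIgnition R)
    (hR' : ∀ v ⦃B C : Finset V⦄, B ⊆ C → R' v B → R' v C)
    (h : ∀ (v : {v // v ∉ S}) o c, Stage R U v o c → R' v c ∧ ¬ R' v o) : IsIgnition R' where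
  mono := hR'
  not_empty v hv := by
    obtain ⟨o, c, hs⟩ := hR.exists_stage U v
    exact (h v o c hs).2 (hR' v (Finset.empty_subset o) hv)
  exists_mem F hF hd := by
    obtain ⟨v, hv, o, c, hs, hc⟩ := hR.exists_stage_disjoint U hF hd
    exact ⟨v, hv, hR' v (Finset.subset_compl_iff_disjoint_left.2 hc) (h v o c hs).1⟩

end Fire

namespace WeightedGraph

/-! ### Trees and parent maps -/

section ParentMap

variable {V E : Type*} {G : WeightedGraph V E}

theorem edgeSet_simple (A : Finset E) :
    (G.simple A).edgeSet =
      (fun e => s(G.src e, G.tgt e)) '' {e | e ∈ A ∧ G.src e ≠ G.tgt e} := by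
  ext z
  induction z using Sym2.ind with
  | h x y =>
    simp only [SimpleGraph.mem_edgeSet, simple, Set.mem_image, Set.mem_ofPred_eq]
    constructor
    · rintro ⟨hne, e, he, h⟩
      refine ⟨e, ⟨he, fun heq => hne ?_⟩, h⟩
      rw [heq] at h
      exact Sym2.mk_isDiag_iff.1 (h ▸ Sym2.mk_isDiag_iff.2 rfl)
    · rintro ⟨e, ⟨he, hne⟩, h⟩
      exact ⟨fun heq => hne (Sym2.mk_isDiag_iff.1 (h ▸ Sym2.mk_isDiag_iff.2 heq)), e, he, h⟩

theorem isSpanningTree_iff_connected_and_card [Finite V] {A : Finset E} :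
    G.IsSpanningTree A ↔ (G.simple A).Connected ∧ A.card + 1 = Nat.card V := by
  classical
  have hedges : Nat.card (G.simple A).edgeSet =
      ((A.filter fun e => G.src e ≠ G.tgt e).image fun e => s(G.src e, G.tgt e)).card := by
    rw [edgeSet_simple, Nat.card_coe_set_eq, ← Set.ncard_coe_finset]
    simp
  rw [IsSpanningTree, SimpleGraph.isTree_iff_connected_and_card, hedges]
  constructor
  · rintro ⟨hloop, hpar, hconn, hcard⟩
    rw [Finset.filter_true_of_mem hloop, Finset.card_image_iff.2 fun e he f hf => hpar e he f hf]
      at hcard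
    exact ⟨hconn, hcard⟩
  · rintro ⟨hconn, hcard⟩
    have hle := hconn.card_vert_le_card_edgeSet_add_one
    rw [hedges, ← hcard, Nat.add_le_add_iff_right] at hle
    have hloop : A.filter (fun e => G.src e ≠ G.tgt e) = A :=
      Finset.eq_of_subset_of_card_le (Finset.filter_subset _ _) (hle.trans Finset.card_image_le)
    rw [hloop] at hle
    have hpar := Finset.card_image_iff.1 (Finset.card_image_le.antisymm hle)
    refine ⟨Finset.filter_eq_self.1 hloop, fun e he f hf => hpar he hf, hconn, ?_⟩
    rw [hloop, Finset.card_image_iff.2 hpar, hcard]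

variable {S : Finset V} {f g : {v // v ∉ S} → E} {p q : {v // v ∉ S} → V}

/-- The map `f` selects for each vertex `v` outside `S` an edge from `v` to a parent `p v`, and
following the parents one eventually arrives in `S`. These maps encode the spanning trees of
`G.wire S`, as trees directed towards the wired vertex. -/
structure IsParentMap (G : WeightedGraph V E) (S : Finset V) (f : {v // v ∉ S} → E)
    (p : {v // v ∉ S} → V) : Prop where
  ends : ∀ v, s(G.src (f v), G.tgt (f v)) = s((v : V), p v)
  wellFounded : WellFounded fun u v : {v // v ∉ S} => (u : V) = p v

theorem IsParentMap.injective (h : G.IsParentMap S f p) : Function.Injective f := by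
  intro v w hvw
  have hends := (h.ends v).symm.trans (hvw ▸ h.ends w)
  rcases Sym2.eq_iff.1 hends with ⟨hv, -⟩ | ⟨hv, hw⟩
  · exact Subtype.ext hv
  · exact absurd hv (h.wellFounded.asymmetric _ _ hw.symm)

theorem IsParentMap.eq_of_image_subset [Fintype V] [DecidableEq V] [DecidableEq E]
    (hf : G.IsParentMap S f p) (hg : G.IsParentMap S g q)
    (hfg : Finset.univ.image f ⊆ Finset.univ.image g) : f = g := by
  funext v
  induction v using hf.wellFounded.induction with
  | _ v ih =>
    obtain ⟨u, -, hu⟩ :=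
      Finset.mem_image.1 (hfg (Finset.mem_image_of_mem f (Finset.mem_univ v)))
    rcases Sym2.eq_iff.1 ((hg.ends u).symm.trans (hu ▸ hf.ends v)) with ⟨huv, -⟩ | ⟨hup, -⟩
    · rw [← hu, Subtype.ext huv]
    · rw [← hu, hf.injective ((ih u hup).trans hu)]

theorem IsParentMap.parent_unique (hf : G.IsParentMap S f p) (hg : G.IsParentMap S f q) :
    p = q :=
  funext fun v => Sym2.congr_right.1 ((hf.ends v).symm.trans (hg.ends v))

variable [DecidableEq V]

/-- The vertex of `G.wire S` into which `v` is wired. -/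
def toWire (S : Finset V) (v : V) : Option {v // v ∉ S} :=
  if h : v ∈ S then none else some ⟨v, h⟩

theorem toWire_of_mem {v : V} (h : v ∈ S) : toWire S v = none := dif_pos h

@[simp]
theorem toWire_coe (v : {v // v ∉ S}) : toWire S (v : V) = some v := dif_neg v.2

theorem toWire_of_notMem {v : V} (h : v ∉ S) : toWire S v = some ⟨v, h⟩ := dif_neg h

theorem toWire_eq_some {v : V} {w : {v // v ∉ S}} : toWire S v = some w ↔ v = w := by
  refine ⟨fun h => ?_, fun h => h ▸ toWire_coe w⟩
  by_cases hv : v ∈ S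
  · simp [toWire_of_mem hv] at h
  · rw [toWire_of_notMem hv] at h
    rw [← Option.some.inj h]

theorem wire_ends (e : E) :
    s((G.wire S).src e, (G.wire S).tgt e) = (s(G.src e, G.tgt e)).map (toWire S) := rfl

theorem IsParentMap.connected [Fintype V] [DecidableEq E] (h : G.IsParentMap S f p) :
    ((G.wire S).simple (Finset.univ.image f)).Connected := by
  rw [SimpleGraph.connected_iff_exists_forall_reachable]
  refine ⟨none, Option.rec (SimpleGraph.Reachable.refl _) fun v => ?_⟩
  induction v using h.wellFounded.induction with
  | _ v ih =>
    have hadj : ((G.wire S).simple (Finset.univ.image f)).Adj (toWire S (p v)) (some v) := by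
      refine ⟨fun hpv => ?_, f v, Finset.mem_image_of_mem f (Finset.mem_univ v), ?_⟩
      · have hv := (toWire_eq_some.1 hpv).symm
        exact h.wellFounded.asymmetric _ _ hv hv
      · rw [wire_ends, h.ends, Sym2.map_mk, toWire_coe, Sym2.eq_swap]
    refine SimpleGraph.Reachable.trans ?_ hadj.reachable
    by_cases hS : p v ∈ S
    · rw [toWire_of_mem hS]
    · rw [toWire_of_notMem hS]
      exact ih _ rfl

theorem IsParentMap.isSpanningTree [Fintype V] [DecidableEq E] (h : G.IsParentMap S f p) :
    (G.wire S).IsSpanningTree (Finset.univ.image f) := by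
  refine isSpanningTree_iff_connected_and_card.2 ⟨h.connected, ?_⟩
  rw [Finset.card_image_of_injective _ h.injective, Finset.card_univ, ← Nat.card_eq_fintype_card,
    Finite.card_option]

theorem IsSpanningTree.card_eq [Finite V] {A : Finset E} (hA : (G.wire S).IsSpanningTree A) :
    A.card = Nat.card {v // v ∉ S} := by
  have hcard := (isSpanningTree_iff_connected_and_card.1 hA).2
  rwa [Finite.card_option, Nat.add_left_inj] at hcard

-- The parent of a vertex is its neighbour on a shortest path to the wired vertex.
theorem IsSpanningTree.exists_parentMap [Fintype V] [DecidableEq E] {A : Finset E}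
    (hA : (G.wire S).IsSpanningTree A) :
    ∃ f p, G.IsParentMap S f p ∧ Finset.univ.image f = A := by
  let depth (v : V) : ℕ := ((G.wire S).simple A).dist (toWire S v) none
  have hparent : ∀ v : {v // v ∉ S}, ∃ e ∈ A, ∃ u, s(G.src e, G.tgt e) = s((v : V), u) ∧
      depth u < depth v := by
    intro v
    obtain ⟨w, hw⟩ := (hA.2.2.connected.preconnected (some v) none).exists_walk_length_eq_dist
    obtain ⟨x, hadj, w, rfl⟩ := SimpleGraph.Walk.exists_eq_cons_of_ne (by simp) w
    have hx : ((G.wire S).simple A).dist x none < depth v := by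
      simpa only [depth, toWire_coe, ← hw, SimpleGraph.Walk.length_cons] using
        Nat.lt_succ_of_le (SimpleGraph.dist_le w)
    obtain ⟨-, e, he, hends⟩ := hadj
    rcases Sym2.eq_iff.1 hends with ⟨hv, rfl⟩ | ⟨rfl, hv⟩
    · exact ⟨e, he, G.tgt e, by rw [toWire_eq_some.1 hv], hx⟩
    · exact ⟨e, he, G.src e, by rw [toWire_eq_some.1 hv, Sym2.eq_swap], hx⟩
  choose f hf p hp hlt using hparent
  have hpm : G.IsParentMap S f p :=
    ⟨hp, Subrelation.wf (fun {u v} huv => (huv ▸ hlt v : depth u < depth v))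
      (measure fun v : {v // v ∉ S} => depth v).wf⟩
  refine ⟨f, p, hpm, Finset.eq_of_subset_of_card_le (Finset.image_subset_iff.2 fun v _ => hf v) ?_⟩
  rw [hA.card_eq, hpm.isSpanningTree.card_eq]

end ParentMap

end WeightedGraph

section Determinant

variable {m n R : Type*} [Fintype m] [DecidableEq m] [CommRing R]

theorem det_mul_eq_sum_prod_mul_det_submatrix [Fintype n] (A : Matrix m n R) (B : Matrix n m R) :
    (A * B).det = ∑ f : m → n, (∏ i, A i (f i)) * (B.submatrix f id).det := by
  classical
  have hrows : A * B = fun i => ∑ k, A i k • B k := by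
    ext i j
    simp [Matrix.mul_apply, Finset.sum_apply]
  rw [hrows]
  change Matrix.detRowAlternating.toMultilinearMap _ = _
  rw [MultilinearMap.map_sum]
  exact Finset.sum_congr rfl fun f _ => MultilinearMap.map_smul_univ _ _ _

theorem det_eq_prod_diag_of_wellFounded {r : m → m → Prop} (hr : WellFounded r)
    {M : Matrix m m R} (hM : ∀ i j, M i j ≠ 0 → j = i ∨ r j i) : M.det = ∏ i, M i i := by
  rw [Matrix.det_apply, Finset.sum_eq_single 1 ?_ (by simp)]
  · simp
  intro σ _ hσ
  suffices ∃ i, M (σ i) i = 0 by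
    obtain ⟨i, hi⟩ := this
    rw [show ∏ i, M (σ i) i = 0 from Finset.prod_eq_zero (Finset.mem_univ i) hi, smul_zero]
  by_contra! hne
  refine hσ (Equiv.ext fun i => ?_)
  induction i using hr.induction with
  | _ i ih =>
    obtain hi | hi := hM _ _ (hne (σ.symm i))
    · rw [σ.apply_symm_apply, Equiv.symm_apply_eq] at hi
      exact hi.symm
    · have hfix := ih _ (by rwa [σ.apply_symm_apply] at hi)
      rw [σ.apply_symm_apply, Equiv.Perm.one_apply, Equiv.eq_symm_apply] at hfix
      exact hfix

end Determinant

namespace WeightedGraph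

/-! ### The matrix-tree theorem -/

section MatrixTree

variable {V E : Type*} [DecidableEq V] {G : WeightedGraph V E}

/-- The signed incidence matrix, restricted to the interior vertices. -/
def incidence (G : WeightedGraph V E) : Matrix G.Interior E ℝ :=
  Matrix.of fun v e => (if G.src e = v then 1 else 0) - (if G.tgt e = v then 1 else 0)

theorem mem_ends_of_incidence_ne_zero {v : G.Interior} {e : E} (h : G.incidence v e ≠ 0) :
    (v : V) ∈ s(G.src e, G.tgt e) := by
  contrapose! h
  rw [Sym2.mem_iff, not_or] at h
  simp [incidence, Ne.symm h.1, Ne.symm h.2]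

theorem incidence_mul_self {v : G.Interior} {e : E} {x : V}
    (h : s(G.src e, G.tgt e) = s((v : V), x)) (hne : x ≠ v) :
    G.incidence v e * G.incidence v e = 1 := by
  rcases Sym2.eq_iff.1 h with ⟨hs, ht⟩ | ⟨hs, ht⟩ <;> simp [incidence, hs, ht, hne]

variable [Fintype V]

theorem sum_incidence_mul (e : E) {X : V → ℝ} (hX : ∀ v ∈ G.bdry, X v = 0) :
    ∑ v : G.Interior, G.incidence v e * X v = X (G.src e) - X (G.tgt e) := by
  have hsum : ∀ x : V, ∑ v : G.Interior, (if x = v then 1 else 0) * X v = X x := by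
    intro x
    by_cases hx : x ∈ G.bdry
    · rw [hX x hx]
      exact Finset.sum_eq_zero fun v _ => by rw [if_neg (by grind), zero_mul]
    · rw [Finset.sum_eq_single ⟨x, hx⟩ (fun v _ hv => ?_) (by simp)]
      · simp
      · rw [if_neg fun h => hv (Subtype.ext h.symm), zero_mul]
  simp only [incidence, Matrix.of_apply, sub_mul, Finset.sum_sub_distrib, hsum]

variable {f : G.Interior → E} {p : G.Interior → V}

theorem IsParentMap.prod_mul_det (h : G.IsParentMap G.bdry f p) :
    (∏ v, G.incidence v (f v)) * (G.incidence.transpose.submatrix f id).det = 1 := by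
  rw [det_eq_prod_diag_of_wellFounded h.wellFounded, ← Finset.prod_mul_distrib]
  · refine Finset.prod_eq_one fun v _ => incidence_mul_self (h.ends v) fun hv => ?_
    exact h.wellFounded.asymmetric v v hv.symm hv.symm
  · intro v u huv
    have hu := mem_ends_of_incidence_ne_zero huv
    rw [h.ends, Sym2.mem_iff] at hu
    exact hu.imp_left fun hu => Subtype.ext hu

-- The indicator function of the vertices from which the parents never lead to the boundary lies
-- in the kernel.
theorem det_incidence_submatrix_eq_zero
    (hends : ∀ v, s(G.src (f v), G.tgt (f v)) = s((v : V), p v))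
    (hp : ¬ WellFounded fun u v : G.Interior => (u : V) = p v) :
    (G.incidence.transpose.submatrix f id).det = 0 := by
  classical
  let trapped (x : V) : Prop :=
    ∃ h : x ∉ G.bdry, ¬ Acc (fun u v : G.Interior => (u : V) = p v) ⟨x, h⟩
  have htrapped : ∀ v : G.Interior, trapped v ↔ trapped (p v) := fun v =>
    ⟨fun ⟨_, hv⟩ => by
      by_contra hpv
      refine hv ⟨_, fun u hu => ?_⟩
      by_contra hacc
      exact hpv ⟨hu ▸ u.2, by simpa only [← hu] using hacc⟩,
    fun ⟨_, hpv⟩ => ⟨v.2, fun hv => hpv (hv.inv rfl)⟩⟩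
  obtain ⟨v, hv⟩ : ∃ v : G.Interior, trapped v := by
    by_contra! hall
    exact hp ⟨fun v => not_not.1 fun hv => hall v ⟨v.2, hv⟩⟩
  refine Matrix.exists_mulVec_eq_zero_iff.1 ⟨fun u => if trapped u then 1 else 0,
    fun h0 => by simpa [hv] using congrFun h0 v, ?_⟩
  funext u
  refine (sum_incidence_mul (f u) (X := fun x => if trapped x then 1 else 0)
    fun x hx => if_neg fun h => h.1 hx).trans ?_
  rcases Sym2.eq_iff.1 (hends u) with ⟨hs, ht⟩ | ⟨hs, ht⟩ <;> simp [hs, ht, htrapped u]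

theorem exists_parentMap_of_prod_mul_det_ne_zero
    (h : (∏ v, G.incidence v (f v)) * (G.incidence.transpose.submatrix f id).det ≠ 0) :
    ∃ p, G.IsParentMap G.bdry f p := by
  have hmem : ∀ v, (v : V) ∈ s(G.src (f v), G.tgt (f v)) := fun v =>
    mem_ends_of_incidence_ne_zero (Finset.prod_ne_zero_iff.1 (left_ne_zero_of_mul h) v
      (Finset.mem_univ v))
  choose p hp using hmem
  exact ⟨p, hp, not_not.1 fun hwf =>
    right_ne_zero_of_mul h (det_incidence_submatrix_eq_zero hp hwf)⟩

theorem mem_spanningTrees {V' : Type*} [Fintype E] {G : WeightedGraph V' E} {A : Finset E} :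
    A ∈ G.spanningTrees ↔ G.IsSpanningTree A := by
  simp [spanningTrees]

variable [Fintype E]

theorem det_incidence_mul_diagonal_mul_transpose [DecidableEq E] (c : E → ℝ) :
    (G.incidence * Matrix.diagonal c * G.incidence.transpose).det =
      ∑ A ∈ G.wired.spanningTrees, ∏ e ∈ A, c e := by
  classical
  simp only [det_mul_eq_sum_prod_mul_det_submatrix, Matrix.mul_diagonal,
    Finset.prod_mul_distrib, mul_right_comm _ (∏ _, c _)]
  rw [← Finset.sum_filter_of_ne (p := fun f => ∃ p, G.IsParentMap G.bdry f p)
    fun f _ hf => exists_parentMap_of_prod_mul_det_ne_zero (left_ne_zero_of_mul hf)]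
  refine Finset.sum_bij (fun f _ => Finset.univ.image f) (fun f hf => ?_) (fun f hf g hg hfg => ?_)
    (fun A hA => ?_) fun f hf => ?_
  · obtain ⟨p, hp⟩ := (Finset.mem_filter.1 hf).2
    exact mem_spanningTrees.2 hp.isSpanningTree
  · obtain ⟨p, hp⟩ := (Finset.mem_filter.1 hf).2
    obtain ⟨q, hq⟩ := (Finset.mem_filter.1 hg).2
    exact hp.eq_of_image_subset hq hfg.subset
  · obtain ⟨f, p, hp, rfl⟩ := (mem_spanningTrees.1 hA).exists_parentMap
    exact ⟨f, Finset.mem_filter.2 ⟨Finset.mem_univ f, p, hp⟩, rfl⟩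
  · obtain ⟨p, hp⟩ := (Finset.mem_filter.1 hf).2
    rw [hp.prod_mul_det, one_mul, Finset.prod_image hp.injective.injOn]

theorem laplacian_eq [DecidableEq E] (hloop : ∀ e, G.src e ≠ G.tgt e) :
    G.laplacian = G.incidence * Matrix.diagonal G.c * G.incidence.transpose := by
  ext u v
  simp only [Matrix.mul_apply (M := _ * _), Matrix.mul_diagonal, Matrix.transpose_apply, laplacian,
    Matrix.of_apply, edgesTo, Finset.sum_filter, ← Finset.sum_neg_distrib, incidence]
  split_ifs with huv
  · subst huv
    refine Finset.sum_congr rfl fun e _ => ?_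
    have := hloop e
    grind
  · refine Finset.sum_congr rfl fun e _ => ?_
    have := hloop e
    have := Subtype.coe_injective.ne huv
    grind

theorem det_laplacian (hloop : ∀ e, G.src e ≠ G.tgt e) : G.laplacian.det = G.wired.treeSum := by
  classical
  rw [laplacian_eq hloop, det_incidence_mul_diagonal_mul_transpose]
  rfl

theorem of_transferCurrent_eq [DecidableEq E] :
    Matrix.of G.transferCurrent =
      G.incidence.transpose * G.laplacian⁻¹ * G.incidence * Matrix.diagonal G.c := by
  have hgreen : ∀ u v : G.Interior, G.laplacian⁻¹ u v = G.green u v := fun u v => by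
    simp [green, u.2, v.2]
  have hleft : ∀ x ∈ G.bdry, ∀ y, G.green x y = 0 := fun x hx y => by simp [green, hx]
  have hright : ∀ x, ∀ y ∈ G.bdry, G.green x y = 0 := fun x y hy => by simp [green, hy]
  ext e f
  have hsum : ∀ v : G.Interior, (G.incidence.transpose * G.laplacian⁻¹) e v =
      G.green (G.src e) v - G.green (G.tgt e) v := fun v => by
    simp only [Matrix.mul_apply, Matrix.transpose_apply, hgreen]
    exact sum_incidence_mul e (X := fun x => G.green x v) fun x hx => hleft x hx v
  rw [Matrix.mul_diagonal, Matrix.mul_apply]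
  simp only [hsum, mul_comm _ (G.incidence _ _)]
  rw [sum_incidence_mul f (X := fun y => G.green (G.src e) y - G.green (G.tgt e) y)
    fun y hy => by simp [hright _ y hy], Matrix.of_apply, transferCurrent]
  ring

theorem detCompl_mul_treeSum [DecidableEq E] (hloop : ∀ e, G.src e ≠ G.tgt e)
    (h0 : G.wired.treeSum ≠ 0) (F : Finset E) :
    G.detCompl F * G.wired.treeSum =
      ∑ A ∈ G.wired.spanningTrees with Disjoint A F, G.weight A := by
  let B : Matrix G.Interior F ℝ := G.incidence.submatrix id (↑)
  let D : Matrix F F ℝ := Matrix.diagonal fun e => G.c e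
  have hdet : G.detCompl F = (1 - B.transpose * (G.laplacian⁻¹ * B * D)).det := by
    rw [detCompl]
    congr 1
    ext e f
    have hT := congrFun (congrFun G.of_transferCurrent_eq e) f
    rw [Matrix.of_apply] at hT
    rw [Matrix.of_apply, Matrix.sub_apply, hT, ← Matrix.mul_assoc, ← Matrix.mul_assoc,
      Matrix.mul_diagonal, Matrix.mul_diagonal]
    rfl
  have hunit : IsUnit G.laplacian.det := by
    rw [det_laplacian hloop]
    exact isUnit_iff_ne_zero.2 h0
  have hdelete : G.laplacian - B * D * B.transpose = G.incidence *
      Matrix.diagonal (fun e => if e ∈ F then 0 else G.c e) * G.incidence.transpose := by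
    ext u w
    rw [laplacian_eq hloop, Matrix.sub_apply, sub_eq_iff_eq_add]
    simp only [Matrix.mul_apply (M := _ * _), Matrix.mul_diagonal, Matrix.transpose_apply, B, D,
      Matrix.submatrix_apply, id]
    rw [Finset.sum_coe_sort F fun e => G.incidence u e * G.c e * G.incidence w e,
      ← Finset.univ_inter F, ← Finset.sum_ite_mem, ← Finset.sum_add_distrib]
    refine Finset.sum_congr rfl fun e _ => ?_
    by_cases he : e ∈ F <;> simp [he]
  rw [hdet, Matrix.det_one_sub_mul_comm, ← det_laplacian hloop, mul_comm, ← Matrix.det_mul,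
    Matrix.mul_sub, Matrix.mul_one, Matrix.mul_assoc, Matrix.mul_assoc,
    Matrix.mul_nonsing_inv_cancel_left _ _ hunit, ← Matrix.mul_assoc, hdelete,
    det_incidence_mul_diagonal_mul_transpose, Finset.sum_filter]
  refine Finset.sum_congr rfl fun A _ => ?_
  split_ifs with hA
  · exact Finset.prod_congr rfl fun e he => if_neg (Finset.disjoint_left.1 hA he)
  · obtain ⟨e, he, heF⟩ := Finset.not_disjoint_iff.1 hA
    exact Finset.prod_eq_zero he (if_pos heF)

end MatrixTree

/-! ### Exchanging spanning trees of a wired subgraph -/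

section Exchange

theorem treeSum_pos {V E : Type*} [Fintype E] {G : WeightedGraph V E} {A : Finset E}
    (hA : G.IsSpanningTree A) : 0 < G.treeSum :=
  Finset.sum_pos (fun _ _ => Finset.prod_pos fun e _ => G.c_pos e) ⟨A, mem_spanningTrees.2 hA⟩

variable {V E : Type*} {G : WeightedGraph V E} {S U : Finset V}
  {f : {v // v ∉ S} → E} {p : {v // v ∉ S} → V}
  {g : {v // v ∉ U} → E} {q : {v // v ∉ U} → V}

theorem IsParentMap.restrict (h : G.IsParentMap S f p) (hSU : S ⊆ U) :
    G.IsParentMap U (restrictOff hSU f) (restrictOff hSU p) :=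
  ⟨fun _ => h.ends _, InvImage.wf
    (fun v : {v // v ∉ U} => (⟨v, fun hv => v.2 (hSU hv)⟩ : {v // v ∉ S})) h.wellFounded⟩

variable [DecidableEq V]

theorem IsParentMap.glue (hf : G.IsParentMap S f p) (hg : G.IsParentMap U g q)
    (hp : ∀ v : {v // v ∉ S}, (v : V) ∈ U → p v ∈ U) :
    G.IsParentMap S (glueOff f g) (glueOff p q) where
  ends v := by
    by_cases hv : (v : V) ∈ U
    · simpa [glueOff, hv] using hf.ends v
    · simpa [glueOff, hv] using hg.ends ⟨v, hv⟩
  wellFounded := by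
    rw [WellFounded.wellFounded_iff_has_min]
    intro s hs
    by_cases hsU : ∃ v ∈ s, (v : V) ∈ U
    · obtain ⟨v, ⟨hv, hvU⟩, hmin⟩ := hf.wellFounded.has_min {v | v ∈ s ∧ (v : V) ∈ U} hsU
      refine ⟨v, hv, fun u hu huv => ?_⟩
      rw [glueOff, dif_pos hvU] at huv
      exact hmin u ⟨hu, huv ▸ hp v hvU⟩ huv
    · push Not at hsU
      obtain ⟨v, hv⟩ := hs
      obtain ⟨w, ⟨hw, hws⟩, hmin⟩ := hg.wellFounded.has_min
        {w | ∃ h : (w : V) ∉ S, (⟨w, h⟩ : {v // v ∉ S}) ∈ s} ⟨⟨v, hsU v hv⟩, v.2, hv⟩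
      refine ⟨_, hws, fun u hu huw => ?_⟩
      rw [glueOff, dif_neg w.2] at huw
      exact hmin ⟨u, hsU u hu⟩ ⟨u.2, hu⟩ huw

variable [Fintype E]

/-- The edges that are not contained in `U`. -/
def edgesOff (G : WeightedGraph V E) (U : Finset V) : Finset E :=
  Finset.univ.filter fun e => G.src e ∉ U ∨ G.tgt e ∉ U

theorem mem_edgesOff {e : E} {x y : V} (h : s(G.src e, G.tgt e) = s(x, y)) :
    e ∈ G.edgesOff U ↔ x ∉ U ∨ y ∉ U := by
  rw [edgesOff, Finset.mem_filter]
  rcases Sym2.eq_iff.1 h with ⟨rfl, rfl⟩ | ⟨rfl, rfl⟩ <;> simp [or_comm]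

theorem IsSpanningTree.subset_edgesOff {T : Finset E} (hT : (G.wire U).IsSpanningTree T) :
    T ⊆ G.edgesOff U := by
  intro e he
  by_contra hU
  rw [mem_edgesOff rfl, not_or, not_not, not_not] at hU
  exact hT.1 e he ((toWire_of_mem hU.1).trans (toWire_of_mem hU.2).symm)

variable [DecidableEq E]

theorem IsParentMap.image_restrictOff_subset [Fintype V] (h : G.IsParentMap S f p)
    (hSU : S ⊆ U) : Finset.univ.image (restrictOff hSU f) ⊆
      Finset.univ.image f ∩ G.edgesOff U := by
  refine Finset.image_subset_iff.2 fun v _ => Finset.mem_inter.2 ⟨?_, ?_⟩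
  · exact Finset.mem_image_of_mem f (Finset.mem_univ _)
  · exact (mem_edgesOff ((h.restrict hSU).ends v)).2 (Or.inl v.2)

theorem IsSpanningTree.eq_inter_edgesOff_of_subset [Finite V] {A T : Finset E}
    (hA : (G.wire S).IsSpanningTree A) (hT : (G.wire U).IsSpanningTree T) (hSU : S ⊆ U)
    (h : A ∩ G.edgesOff U ⊆ T) : A ∩ G.edgesOff U = T := by
  have := Fintype.ofFinite V
  obtain ⟨f, p, hf, rfl⟩ := hA.exists_parentMap
  refine Finset.eq_of_subset_of_card_le h ?_
  rw [hT.card_eq, ← (hf.restrict hSU).isSpanningTree.card_eq]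
  exact Finset.card_le_card (hf.image_restrictOff_subset hSU)

theorem IsSpanningTree.disjoint_edgesOff_sdiff_iff [Finite V] {A T : Finset E}
    (hA : (G.wire S).IsSpanningTree A) (hT : (G.wire U).IsSpanningTree T) (hSU : S ⊆ U) :
    Disjoint A (G.edgesOff U \ T) ↔ A ∩ G.edgesOff U = T := by
  refine ⟨fun h => hA.eq_inter_edgesOff_of_subset hT hSU ?_, ?_⟩
  · rw [← Finset.sdiff_eq_empty_iff_subset, Finset.inter_sdiff_assoc]
    exact Finset.disjoint_iff_inter_eq_empty.1 h
  · rintro rfl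
    rw [Finset.sdiff_inter_self_right]
    exact Finset.disjoint_sdiff

theorem IsParentMap.image_restrictOff_eq [Fintype V] (h : G.IsParentMap S f p) (hSU : S ⊆ U)
    (hp : ∀ v : {v // v ∉ S}, (v : V) ∈ U → p v ∈ U) :
    Finset.univ.image (restrictOff hSU f) = Finset.univ.image f ∩ G.edgesOff U := by
  refine (h.image_restrictOff_subset hSU).antisymm fun e he => ?_
  obtain ⟨heA, heU⟩ := Finset.mem_inter.1 he
  obtain ⟨v, -, rfl⟩ := Finset.mem_image.1 heA
  have hv : (v : V) ∉ U := fun hv =>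
    ((mem_edgesOff (h.ends v)).1 heU).elim (· hv) (· (hp v hv))
  exact Finset.mem_image.2 ⟨⟨v, hv⟩, Finset.mem_univ _, rfl⟩

theorem IsParentMap.isSpanningTree_inter_edgesOff_iff [Fintype V] (h : G.IsParentMap S f p)
    (hSU : S ⊆ U) :
    (G.wire U).IsSpanningTree (Finset.univ.image f ∩ G.edgesOff U) ↔
      ∀ v : {v // v ∉ S}, (v : V) ∈ U → p v ∈ U := by
  have htree := (h.restrict hSU).isSpanningTree
  refine ⟨fun hT v hvU => ?_, fun hp => h.image_restrictOff_eq hSU hp ▸ htree⟩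
  by_contra hpv
  have hfv : f v ∈ Finset.univ.image f ∩ G.edgesOff U := Finset.mem_inter.2
    ⟨Finset.mem_image_of_mem f (Finset.mem_univ v), (mem_edgesOff (h.ends v)).2 (Or.inr hpv)⟩
  rw [← Finset.eq_of_subset_of_card_le (h.image_restrictOff_subset hSU)
    (hT.card_eq.trans htree.card_eq.symm).le] at hfv
  obtain ⟨w, -, hw⟩ := Finset.mem_image.1 hfv
  have hwv : (w : V) = v := congrArg Subtype.val (h.injective hw)
  exact w.2 (hwv ▸ hvU)

theorem union_inter_eq_right_of_disjoint {α : Type*} [DecidableEq α] {B C T : Finset α}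
    (hB : Disjoint B C) (hT : T ⊆ C) : (B ∪ T) ∩ C = T := by
  rw [Finset.union_inter_distrib_right, Finset.disjoint_iff_inter_eq_empty.1 hB,
    Finset.empty_union, Finset.inter_eq_left.2 hT]

theorem IsSpanningTree.exchange [Finite V] {B T T₀ : Finset E} (hSU : S ⊆ U)
    (hB : Disjoint B (G.edgesOff U)) (hT : (G.wire U).IsSpanningTree T)
    (hT₀ : (G.wire U).IsSpanningTree T₀) (hA : (G.wire S).IsSpanningTree (B ∪ T)) :
    (G.wire S).IsSpanningTree (B ∪ T₀) := by
  have := Fintype.ofFinite V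
  have hBT := hB.mono_right hT.subset_edgesOff
  have hcard : (B ∪ T₀).card ≤ (B ∪ T).card := by
    rw [Finset.card_union_of_disjoint hBT, hT.card_eq, ← hT₀.card_eq]
    exact Finset.card_union_le _ _
  have hinter := union_inter_eq_right_of_disjoint hB hT.subset_edgesOff
  obtain ⟨f, p, hf, hfA⟩ := hA.exists_parentMap
  obtain ⟨g, q, hg, rfl⟩ := hT₀.exists_parentMap
  have hp := (hf.isSpanningTree_inter_edgesOff_iff hSU).1 (by rwa [hfA, hinter])
  have hglue := (hf.glue hg hp).isSpanningTree
  rwa [Finset.eq_of_subset_of_card_le (s := Finset.univ.image (glueOff f g))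
    (t := B ∪ Finset.univ.image g) ?_ ?_] at hglue
  · refine Finset.image_subset_iff.2 fun v _ => ?_
    by_cases hv : (v : V) ∈ U
    · have hfv : f v ∈ B ∪ T := hfA ▸ Finset.mem_image_of_mem f (Finset.mem_univ v)
      have hfT : f v ∉ T := fun h =>
        ((mem_edgesOff (hf.ends v)).1 (hT.subset_edgesOff h)).elim (· hv) (· (hp v hv))
      simpa [glueOff, hv] using Or.inl ((Finset.mem_union.1 hfv).resolve_right hfT)
    · simp [glueOff, hv]
  · rw [hglue.card_eq, ← hA.card_eq]
    exact hcard

theorem exists_sum_weight_eq_mul_weight [Finite V] (hSU : S ⊆ U) :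
    ∃ κ, ∀ T, (G.wire U).IsSpanningTree T →
      ∑ A ∈ (G.wire S).spanningTrees with A ∩ G.edgesOff U = T, G.weight A = κ * G.weight T := by
  classical
  refine ⟨∑ B with Disjoint B (G.edgesOff U) ∧
    ∃ T, (G.wire U).IsSpanningTree T ∧ (G.wire S).IsSpanningTree (B ∪ T), G.weight B,
    fun T hT => ?_⟩
  rw [Finset.sum_mul]
  refine Finset.sum_bij' (fun A _ => A \ G.edgesOff U) (fun B _ => B ∪ T) ?_ ?_ ?_ ?_ ?_
  · intro A hA
    obtain ⟨htree, rfl⟩ := Finset.mem_filter.1 hA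
    rw [Finset.mem_filter]
    refine ⟨Finset.mem_univ _, Finset.sdiff_disjoint, _, hT, ?_⟩
    rw [Finset.sdiff_union_inter]
    exact mem_spanningTrees.1 htree
  · intro B hB
    obtain ⟨-, hB, T', hT', hA⟩ := Finset.mem_filter.1 hB
    rw [Finset.mem_filter, mem_spanningTrees]
    exact ⟨IsSpanningTree.exchange hSU hB hT' hT hA,
      union_inter_eq_right_of_disjoint hB hT.subset_edgesOff⟩
  · intro A hA
    obtain ⟨-, rfl⟩ := Finset.mem_filter.1 hA
    exact Finset.sdiff_union_inter _ _
  · intro B hB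
    obtain ⟨-, hB, -⟩ := Finset.mem_filter.1 hB
    rw [Finset.union_sdiff_distrib, Finset.sdiff_eq_self_of_disjoint hB,
      Finset.sdiff_eq_empty_iff_subset.2 hT.subset_edgesOff, Finset.union_empty]
  · intro A hA
    obtain ⟨-, rfl⟩ := Finset.mem_filter.1 hA
    rw [weight, weight, weight, ← Finset.prod_union
      (Finset.disjoint_of_subset_right Finset.inter_subset_right Finset.sdiff_disjoint),
      Finset.sdiff_union_inter]

variable [Fintype V]

theorem detCompl_edgesOff_sdiff (hloop : ∀ e, G.src e ≠ G.tgt e) (h0 : G.wired.treeSum ≠ 0)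
    (hU : G.bdry ⊆ U) {T : Finset E} (hT : (G.wire U).IsSpanningTree T) :
    G.detCompl (G.edgesOff U \ T) =
      (∑ A ∈ G.wired.spanningTrees with A ∩ G.edgesOff U = T, G.weight A) / G.wired.treeSum := by
  rw [eq_div_iff h0, detCompl_mul_treeSum hloop h0]
  exact Finset.sum_congr (Finset.filter_congr fun A hA =>
    (mem_spanningTrees.1 hA).disjoint_edgesOff_sdiff_iff hT hU) fun _ _ => rfl

theorem detCompl_edgesOff_sdiff_eq_sum (hloop : ∀ e, G.src e ≠ G.tgt e)
    (h0 : G.wired.treeSum ≠ 0) (hU : G.bdry ⊆ U) {T₀ : Finset E}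
    (hT₀ : (G.wire U).IsSpanningTree T₀) :
    G.detCompl (G.edgesOff U \ T₀) = ∑ T ∈ (G.wire U).spanningTrees,
      (G.wire U).weight T₀ / (G.wire U).treeSum * G.detCompl (G.edgesOff U \ T) := by
  obtain ⟨κ, hκ⟩ := exists_sum_weight_eq_mul_weight (G := G) hU
  have hdet : ∀ T, (G.wire U).IsSpanningTree T → G.detCompl (G.edgesOff U \ T) =
      κ / G.wired.treeSum * (G.wire U).weight T := fun T hT => by
    rw [detCompl_edgesOff_sdiff hloop h0 hU hT, hκ T hT, mul_div_right_comm]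
    rfl
  rw [Finset.sum_congr rfl fun T hT => by rw [hdet T (mem_spanningTrees.1 hT)], ← Finset.mul_sum,
    ← Finset.mul_sum, ← treeSum, hdet T₀ hT₀]
  field_simp [(treeSum_pos hT₀).ne']

end Exchange

end WeightedGraph

section Position

variable {α : Type*} {r : α → ℕ} {s : Finset α} {a b : α} {i : ℕ}

/-- The number of elements of `s` that precede `a` in the order given by the ranks `r`. -/
def position (r : α → ℕ) (s : Finset α) (a : α) : ℕ := (s.filter fun b => r b < r a).card

theorem position_lt_card (ha : a ∈ s) : position r s a < s.card :=
  Finset.card_lt_card (Finset.filter_ssubset.2 ⟨a, ha, lt_irrefl _⟩)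

theorem position_lt_position (ha : a ∈ s) (h : r a < r b) : position r s a < position r s b := by
  refine Finset.card_lt_card ((Finset.ssubset_iff_of_subset ?_).2
    ⟨a, Finset.mem_filter.2 ⟨ha, h⟩, fun h' => lt_irrefl _ (Finset.mem_filter.1 h').2⟩)
  exact Finset.monotone_filter_right s fun x _ hx => hx.trans h

theorem position_injOn (hr : Set.InjOn r s) : Set.InjOn (position r s) s := by
  intro a ha b hb h
  rcases lt_trichotomy (r a) (r b) with hlt | heq | hlt
  · exact absurd h (position_lt_position ha hlt).ne
  · exact hr ha hb heq
  · exact absurd h (position_lt_position hb hlt).ne'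

theorem exists_position_eq (hr : Set.InjOn r s) (hi : i < s.card) :
    ∃ a ∈ s, position r s a = i := by
  have himage : s.image (position r s) = Finset.range s.card := by
    refine Finset.eq_of_subset_of_card_le (Finset.image_subset_iff.2 fun a ha => ?_) ?_
    · exact Finset.mem_range.2 (position_lt_card ha)
    · rw [Finset.card_range, Finset.card_image_of_injOn (position_injOn hr)]
  exact Finset.mem_image.1 (himage ▸ Finset.mem_range.2 hi)

end Position

section ParentRule

variable {V : Type*} {S : Finset V} {p : {v // v ∉ S} → V}

/-- The rule under which a vertex burns as soon as its parent is burnt. -/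
def parentRule (p : {v // v ∉ S} → V) (v : {v // v ∉ S}) (B : Finset V) : Prop := p v ∈ B

theorem parentRule_mono (v : {v // v ∉ S}) ⦃B C : Finset V⦄ (h : B ⊆ C) (hv : parentRule p v B) :
    parentRule p v C :=
  h hv

variable [Fintype V] [DecidableEq V]

theorem isIgnition_parentRule :
    IsIgnition (parentRule p) ↔ WellFounded fun u v : {v // v ∉ S} => (u : V) = p v := by
  classical
  rw [WellFounded.wellFounded_iff_has_min]
  constructor
  · rintro hR s ⟨v, hv⟩
    obtain ⟨w, hw, hpw⟩ := hR.exists_mem (s.toFinset.map (Function.Embedding.subtype _))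
      ⟨v, by simpa [v.2] using hv⟩ (Finset.disjoint_left.2 fun x hx => by
        obtain ⟨u, -, rfl⟩ := Finset.mem_map.1 hx
        exact u.2)
    refine ⟨w, by simpa [w.2] using hw, fun u hu huw => ?_⟩
    rw [parentRule, ← huw, Finset.mem_compl] at hpw
    exact hpw (by simpa [u.2] using hu)
  · refine fun hwf => ⟨parentRule_mono, fun v => Finset.notMem_empty _, ?_⟩
    rintro F ⟨x, hx⟩ hd
    obtain ⟨v, hv, hmin⟩ := hwf {v | (v : V) ∈ F} ⟨⟨x, Finset.disjoint_left.1 hd hx⟩, hx⟩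
    refine ⟨v, hv, Finset.mem_compl.2 fun hpv => ?_⟩
    exact hmin ⟨p v, Finset.disjoint_left.1 hd hpv⟩ hpv rfl

end ParentRule

namespace WeightedGraph

/-! ### The burning bijection -/

section Burning

variable {V E : Type*} [Fintype V] [DecidableEq V] [Fintype E] {G : WeightedGraph V E}
  {S U : Finset V} {η η' : {v // v ∉ S} → ℕ} {rank : {v // v ∉ S} → E → ℕ}
  {f f' : {v // v ∉ S} → E} {p p' : {v // v ∉ S} → V}

/-- The burning rule of a configuration: a vertex burns if its height is at least the number of
its edges to unburnt vertices. -/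
def heightRule (G : WeightedGraph V E) (η : {v // v ∉ S} → ℕ) (v : {v // v ∉ S})
    (B : Finset V) : Prop :=
  (G.edgesTo v Bᶜ).card ≤ η v

theorem heightRule_mono (v : {v // v ∉ S}) ⦃B C : Finset V⦄ (h : B ⊆ C)
    (hv : G.heightRule η v B) : G.heightRule η v C :=
  (card_edgesTo_mono (v : V) (Finset.compl_subset_compl.2 h)).trans hv

theorem isIgnition_heightRule {η : G.Interior → ℕ} :
    IsIgnition (G.heightRule η) ↔ G.Stable η ∧ G.IsAllowed η := by
  refine ⟨fun h => ⟨fun v => ?_, fun F hF hd => ?_⟩,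
    fun ⟨hs, ha⟩ => ⟨heightRule_mono, fun v => ?_, ?_⟩⟩
  · simpa [heightRule, deg] using h.not_empty v
  · simpa only [heightRule, compl_compl] using h.exists_mem F hF hd
  · simpa [heightRule, deg] using hs v
  · intro F hF hd
    simpa only [heightRule, compl_compl] using ha F hF hd

theorem burnt_eq_fire (η : G.Interior → ℕ) (A X : Finset V) :
    G.burnt η A X = fire (G.heightRule η) A X := by
  funext k
  induction k using Nat.twoStepInduction with
  | zero => rfl
  | one => rfl
  | more k _ ih => ext v; simp [burnt, mem_fire_add_two_iff_exists, ih, heightRule]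

theorem allBurnt_eq_burntOut (η : G.Interior → ℕ) (A X : Finset V) :
    G.allBurnt η A X = burntOut (G.heightRule η) A X := by
  rw [allBurnt, burntOut, burnt_eq_fire]

/-- The edge `e` is the one that the vertex `v` selects if it burns just after the vertices of
`c \ o`, where `c` is the set of all vertices burnt before `v`. -/
def Selects (G : WeightedGraph V E) (rank : {v // v ∉ S} → E → ℕ) (η : {v // v ∉ S} → ℕ)
    (v : {v // v ∉ S}) (o c : Finset V) (e : E) : Prop :=
  e ∈ G.edgesTo v (c \ o) ∧
    η v = (G.edgesTo v cᶜ).card + position (rank v) (G.edgesTo v (c \ o)) e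

theorem mem_fireEdges {rank : G.Interior → E → ℕ} {η : G.Interior → ℕ} {A X : Finset V} {e : E} :
    e ∈ G.fireEdges rank η A X ↔
      ∃ (v : G.Interior) (o c : Finset V),
        BurnsAfter (G.heightRule η) A X v o c ∧ G.Selects rank η v o c e := by
  simp only [fireEdges, Finset.mem_filter, Finset.mem_univ, true_and, burnt_eq_fire, Selects,
    position]
  constructor
  · rintro ⟨v, k, hv, he, h⟩
    exact ⟨v, _, _, ⟨k, hv, rfl, rfl⟩, he, by convert h⟩
  · rintro ⟨v, _, _, ⟨k, hv, rfl, rfl⟩, he, h⟩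
    exact ⟨v, k, hv, he, by convert h⟩

theorem mem_burningMap [DecidableEq E] {rank : G.Interior → E → ℕ} {W : Finset G.Interior}
    {η : G.Interior → ℕ} {e : E} :
    e ∈ G.burningMap rank W η ↔
      ∃ (v : G.Interior) (o c : Finset V),
        Stage (G.heightRule η) (toVerts W)ᶜ v o c ∧ G.Selects rank η v o c e := by
  simp only [burningMap, Finset.mem_union, mem_fireEdges, allBurnt_eq_burntOut, Stage, or_and_right,
    exists_or]

section Selects

variable {v : {v // v ∉ S}} {o c : Finset V} {e : E}

theorem Selects.unique {e' : E} (hrank : Set.InjOn (rank v) (G.edgesTo (v : V) Finset.univ))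
    (h : G.Selects rank η v o c e) (h' : G.Selects rank η v o c e') : e = e' := by
  have hinj : Set.InjOn (rank v) (G.edgesTo (v : V) (c \ o)) :=
    hrank.mono (edgesTo_mono (v : V) (Finset.subset_univ _))
  exact position_injOn hinj h.1 h'.1 (Nat.add_left_cancel (h.2.symm.trans h'.2))

theorem exists_selects (hrank : Set.InjOn (rank v) (G.edgesTo (v : V) Finset.univ))
    (hoc : o ⊆ c) (hc : G.heightRule η v c) (ho : ¬ G.heightRule η v o) :
    ∃ e, G.Selects rank η v o c e := by
  have hcard := card_edgesTo_compl_add_sdiff (G := G) (v : V) hoc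
  rw [heightRule] at hc ho
  obtain ⟨e, he, hpos⟩ := exists_position_eq (i := η v - (G.edgesTo v cᶜ).card)
    (hrank.mono (edgesTo_mono (v : V) (Finset.subset_univ (c \ o)))) (by omega)
  exact ⟨e, he, by omega⟩

theorem Selects.heightRule (h : G.Selects rank η v o c e) : G.heightRule η v c :=
  (Nat.le_add_right _ _).trans h.2.ge

theorem Selects.not_heightRule (hoc : o ⊆ c) (h : G.Selects rank η v o c e) :
    ¬ G.heightRule η v o := by
  rw [WeightedGraph.heightRule, not_le, h.2, ← card_edgesTo_compl_add_sdiff (v : V) hoc]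
  exact Nat.add_lt_add_left (position_lt_card h.1) _

end Selects

/-- The edges `f v`, leading to the parents `p v`, are those that the vertices select when the
configuration `η` burns in two phases, of which the first is confined to `U`. -/
structure IsSelection (G : WeightedGraph V E) (rank : {v // v ∉ S} → E → ℕ) (U : Finset V)
    (η : {v // v ∉ S} → ℕ) (f : {v // v ∉ S} → E) (p : {v // v ∉ S} → V) : Prop where
  ends : ∀ v, s(G.src (f v), G.tgt (f v)) = s((v : V), p v)
  selects : ∀ (v : {v // v ∉ S}) o c, Stage (G.heightRule η) U v o c →
    p v ∈ c \ o ∧ G.Selects rank η v o c (f v)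

theorem exists_isSelection
    (hrank : ∀ v : {v // v ∉ S}, Set.InjOn (rank v) (G.edgesTo (v : V) Finset.univ))
    (hR : IsIgnition (G.heightRule η)) (U : Finset V) : ∃ f p, G.IsSelection rank U η f p := by
  choose o c hs using hR.exists_stage U
  choose f hf using fun v =>
    exists_selects (hrank v) (hs v).subset (hs v).rule ((hs v).not_rule (hR.not_empty v))
  choose p hp hends using fun v => mem_edgesTo.1 (hf v).1
  refine ⟨f, p, hends, fun v o' c' h => ?_⟩
  obtain ⟨rfl, rfl⟩ := (hs v).eq h
  exact ⟨hp v, hf v⟩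

namespace IsSelection

theorem parentRule_iff (h : G.IsSelection rank U η f p) {v : {v // v ∉ S}} {o c : Finset V}
    (hs : Stage (G.heightRule η) U v o c) : parentRule p v c ∧ ¬ parentRule p v o :=
  Finset.mem_sdiff.1 (h.selects v o c hs).1

theorem stage_parentRule_iff (h : G.IsSelection rank U η f p)
    (hR : IsIgnition (G.heightRule η)) {v : V} {o c : Finset V} :
    Stage (parentRule p) U v o c ↔ Stage (G.heightRule η) U v o c :=
  hR.stage_iff parentRule_mono fun _ _ _ hs => h.parentRule_iff hs

theorem isParentMap (h : G.IsSelection rank U η f p) (hR : IsIgnition (G.heightRule η)) :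
    G.IsParentMap S f p :=
  ⟨h.ends, isIgnition_parentRule.1
    (hR.of_stage parentRule_mono fun _ _ _ hs => h.parentRule_iff hs)⟩

theorem height_unique (h : G.IsSelection rank U η f p) (h' : G.IsSelection rank U η' f p)
    (hR : IsIgnition (G.heightRule η)) (hR' : IsIgnition (G.heightRule η')) : η = η' := by
  funext v
  obtain ⟨o, c, hs⟩ := hR.exists_stage U v
  have hs' := (h'.stage_parentRule_iff hR').1 ((h.stage_parentRule_iff hR).2 hs)
  rw [(h.selects v o c hs).2.2, (h'.selects v o c hs').2.2]

theorem edge_unique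
    (hrank : ∀ v : {v // v ∉ S}, Set.InjOn (rank v) (G.edgesTo (v : V) Finset.univ))
    (h : G.IsSelection rank U η f p) (h' : G.IsSelection rank U η f' p')
    (hR : IsIgnition (G.heightRule η)) : f = f' := by
  funext v
  obtain ⟨o, c, hs⟩ := hR.exists_stage U v
  exact (h.selects v o c hs).2.unique (hrank v) (h'.selects v o c hs).2

theorem eq_iff_image_eq [DecidableEq E]
    (hrank : ∀ v : {v // v ∉ S}, Set.InjOn (rank v) (G.edgesTo (v : V) Finset.univ))
    (h : G.IsSelection rank U η f p) (h' : G.IsSelection rank U η' f' p')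
    (hR : IsIgnition (G.heightRule η)) (hR' : IsIgnition (G.heightRule η')) :
    η = η' ↔ Finset.univ.image f = Finset.univ.image f' := by
  constructor
  · rintro rfl
    rw [h.edge_unique hrank h' hR]
  · intro himage
    obtain rfl := (h.isParentMap hR).eq_of_image_subset (h'.isParentMap hR') himage.subset
    obtain rfl := (h.isParentMap hR).parent_unique (h'.isParentMap hR')
    exact h.height_unique h' hR hR'

end IsSelection

-- The heights are read off from the fire that spreads along the parent map.
theorem IsParentMap.exists_isSelection (h : G.IsParentMap S f p)
    (rank : {v // v ∉ S} → E → ℕ) (U : Finset V) :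
    ∃ η, IsIgnition (G.heightRule η) ∧ G.IsSelection rank U η f p := by
  have hp : IsIgnition (parentRule p) := isIgnition_parentRule.2 h.wellFounded
  choose o c hs using hp.exists_stage U
  let η : {v // v ∉ S} → ℕ := fun v =>
    (G.edgesTo v (c v)ᶜ).card + position (rank v) (G.edgesTo v (c v \ o v)) (f v)
  have hmem : ∀ (v : {v // v ∉ S}) o c, Stage (parentRule p) U v o c →
      p v ∈ c \ o := fun v o c hs =>
    Finset.mem_sdiff.2 ⟨hs.rule, hs.not_rule (hp.not_empty v)⟩
  have hsel : ∀ (v : {v // v ∉ S}) o c, Stage (parentRule p) U v o c →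
      G.Selects rank η v o c (f v) := by
    intro v o' c' hs'
    obtain ⟨rfl, rfl⟩ := (hs v).eq hs'
    exact ⟨mem_edgesTo.2 ⟨p v, hmem _ _ _ hs', h.ends v⟩, rfl⟩
  have hrule : ∀ (v : {v // v ∉ S}) o c, Stage (parentRule p) U v o c →
      G.heightRule η v c ∧ ¬ G.heightRule η v o := fun v o c hs =>
    ⟨(hsel v o c hs).heightRule, (hsel v o c hs).not_heightRule hs.subset⟩
  refine ⟨η, hp.of_stage heightRule_mono hrule, h.ends, fun v o c hs => ?_⟩
  rw [hp.stage_iff heightRule_mono hrule] at hs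
  exact ⟨hmem v o c hs, hsel v o c hs⟩

section Bijection

variable [DecidableEq E] {rank : G.Interior → E → ℕ} {W : Finset G.Interior} {η : G.Interior → ℕ}
  {f : G.Interior → E} {p : G.Interior → V}

theorem IsSelection.burningMap_eq
    (hrank : ∀ v : G.Interior, Set.InjOn (rank v) (G.edgesTo (v : V) Finset.univ))
    (h : G.IsSelection rank (toVerts W)ᶜ η f p) (hR : IsIgnition (G.heightRule η)) :
    G.burningMap rank W η = Finset.univ.image f := by
  ext e
  rw [mem_burningMap, Finset.mem_image]
  constructor
  · rintro ⟨v, o, c, hs, he⟩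
    exact ⟨v, Finset.mem_univ v, (h.selects v o c hs).2.unique (hrank v) he⟩
  · rintro ⟨v, -, rfl⟩
    obtain ⟨o, c, hs⟩ := hR.exists_stage (toVerts W)ᶜ v
    exact ⟨v, o, c, hs, (h.selects v o c hs).2⟩

theorem bijOn_burningMap (hloop : ∀ e, G.src e ≠ G.tgt e) (hconn : G.IsConn)
    (hbdry : G.bdry.Nonempty)
    (hrank : ∀ v : G.Interior, Set.InjOn (rank v) (G.edgesTo (v : V) Finset.univ))
    (W : Finset G.Interior) :
    Set.BijOn (G.burningMap rank W) {η | G.Recurrent η} {A | G.wired.IsSpanningTree A} := by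
  simp only [recurrent_iff hloop hconn hbdry, ← isIgnition_heightRule]
  refine ⟨fun η hη => ?_, fun η hη η' hη' heq => ?_, fun A hA => ?_⟩
  · obtain ⟨f, p, h⟩ := exists_isSelection hrank hη (toVerts W)ᶜ
    rw [Set.mem_ofPred_eq, h.burningMap_eq hrank hη]
    exact (h.isParentMap hη).isSpanningTree
  · obtain ⟨f, p, h⟩ := exists_isSelection hrank hη (toVerts W)ᶜ
    obtain ⟨f', p', h'⟩ := exists_isSelection hrank hη' (toVerts W)ᶜ
    rw [h.burningMap_eq hrank hη, h'.burningMap_eq hrank hη'] at heq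
    exact (h.eq_iff_image_eq hrank h' hη hη').2 heq
  · obtain ⟨f, p, h, rfl⟩ := IsSpanningTree.exists_parentMap hA
    obtain ⟨η, hη, h⟩ := h.exists_isSelection rank (toVerts W)ᶜ
    exact ⟨η, hη, h.burningMap_eq hrank hη⟩

end Bijection

end Burning

/-! ### Minimal subconfigurations -/

section Restriction

variable {V E : Type*} [Fintype V] [DecidableEq V] [Fintype E] {G : WeightedGraph V E}
  {S U : Finset V} {η η' : {v // v ∉ S} → ℕ} {rank : {v // v ∉ S} → E → ℕ}
  {f f' : {v // v ∉ S} → E} {p p' : {v // v ∉ S} → V}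

theorem IsSelection.burntOut_eq_iff (h : G.IsSelection rank U η f p)
    (hR : IsIgnition (G.heightRule η)) (hSU : S ⊆ U) :
    burntOut (G.heightRule η) U S = U ↔ ∀ v : {v // v ∉ S}, (v : V) ∈ U → p v ∈ U := by
  constructor
  · intro hU v hv
    obtain ⟨o, c, hs⟩ := hR.exists_stage U v
    have hpv := (Finset.mem_sdiff.1 (h.selects v o c hs).1).1
    obtain hs | hs := hs
    · exact hU ▸ hs.subset_burntOut hpv
    · exact absurd (hU.symm ▸ hv) hs.notMem_start
  · intro hp
    by_contra hU
    have hF : (U \ burntOut (G.heightRule η) U S).Nonempty :=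
      Finset.sdiff_nonempty.2 fun hle => hU ((burntOut_subset hSU).antisymm hle)
    obtain ⟨v, hv, o, c, hs, hd⟩ := hR.exists_stage_disjoint U hF
      (Finset.sdiff_disjoint.mono_right subset_burntOut)
    obtain ⟨hvU, hvb⟩ := Finset.mem_sdiff.1 hv
    obtain ⟨hpc, hpo⟩ := Finset.mem_sdiff.1 (h.selects v o c hs).1
    have hpb : p v ∈ burntOut (G.heightRule η) U S := by
      by_contra hpb
      exact Finset.disjoint_left.1 hd (Finset.mem_sdiff.2 ⟨hp v hvU, hpb⟩) hpc
    exact hpo (hs.burntOut_subset (heightRule_mono v) hvU hvb hpb)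

theorem IsSelection.restrict (h : G.IsSelection rank U η f p) (hSU : S ⊆ U)
    (hU : burntOut (G.heightRule η) U S = U) :
    G.IsSelection (restrictOff hSU rank) U (restrictOff hSU η) (restrictOff hSU f)
      (restrictOff hSU p) :=
  ⟨fun _ => h.ends _, fun _ o c hs => h.selects _ o c (hs.of_restrictOff hSU hU)⟩

variable [DecidableEq E]

theorem IsSelection.restrictOff_eq_iff
    (hrank : ∀ v : {v // v ∉ S}, Set.InjOn (rank v) (G.edgesTo (v : V) Finset.univ))
    (h : G.IsSelection rank U η f p) (h' : G.IsSelection rank U η' f' p')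
    (hR : IsIgnition (G.heightRule η)) (hR' : IsIgnition (G.heightRule η')) (hSU : S ⊆ U)
    (hU : burntOut (G.heightRule η) U S = U) (hU' : burntOut (G.heightRule η') U S = U) :
    restrictOff hSU η = restrictOff hSU η' ↔
      Finset.univ.image f ∩ G.edgesOff U = Finset.univ.image f' ∩ G.edgesOff U := by
  rw [(h.restrict hSU hU).eq_iff_image_eq (fun v => hrank ⟨v, fun hv => v.2 (hSU hv)⟩)
      (h'.restrict hSU hU')
      (hR.restrict hSU) (hR'.restrict hSU),
    (h.isParentMap hR).image_restrictOff_eq hSU ((h.burntOut_eq_iff hR hSU).1 hU),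
    (h'.isParentMap hR').image_restrictOff_eq hSU ((h'.burntOut_eq_iff hR' hSU).1 hU')]

end Restriction

section Minimal

variable {V E : Type*} {G : WeightedGraph V E} {W : Finset G.Interior} {η : G.Interior → ℕ}
  {ξ : W → ℕ}

@[simp]
theorem coe_mem_toVerts {v : G.Interior} : (v : V) ∈ toVerts W ↔ v ∈ W := by
  simp [toVerts, v.2]

theorem disjoint_toVerts_bdry : Disjoint (toVerts W) G.bdry := by
  refine Finset.disjoint_left.2 fun v hv => ?_
  obtain ⟨w, -, rfl⟩ := Finset.mem_map.1 hv
  exact w.2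

variable [Fintype V] [DecidableEq V]

theorem bdry_subset_compl_toVerts : G.bdry ⊆ (toVerts W)ᶜ :=
  Finset.subset_compl_iff_disjoint_left.2 disjoint_toVerts_bdry

theorem restrictOff_eq_iff {η₀ : G.Interior → ℕ} (h₀ : RestrictsTo η₀ ξ) :
    restrictOff (bdry_subset_compl_toVerts (W := W)) η =
      restrictOff (bdry_subset_compl_toVerts (W := W)) η₀ ↔ RestrictsTo η ξ := by
  rw [funext_iff]
  refine ⟨fun h w => ?_, fun h v => ?_⟩
  · exact (h ⟨w, by simp⟩).trans (h₀ w)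
  · have hv : (⟨v, fun hv => v.2 (bdry_subset_compl_toVerts hv)⟩ : G.Interior) ∈ W := by
      simpa [← coe_mem_toVerts] using v.2
    exact (h ⟨_, hv⟩).trans (h₀ ⟨_, hv⟩).symm

variable [Fintype E]

theorem edgesAt_eq_edgesOff : G.edgesAt W = G.edgesOff (toVerts W)ᶜ := by
  simp [edgesAt, edgesOff]

theorem recurrent_iff_isIgnition (hloop : ∀ e, G.src e ≠ G.tgt e) (hconn : G.IsConn)
    (hbdry : G.bdry.Nonempty) : G.Recurrent η ↔ IsIgnition (G.heightRule η) := by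
  rw [recurrent_iff hloop hconn hbdry, isIgnition_heightRule]

theorem extendable_iff (hloop : ∀ e, G.src e ≠ G.tgt e) (hconn : G.IsConn)
    (hbdry : G.bdry.Nonempty)
    (hW : ∀ v ∉ toVerts W, ∃ b ∈ G.bdry, ∃ p : (G.simple Finset.univ).Walk v b,
      ∀ x ∈ p.support, x ∉ toVerts W) :
    G.Extendable ξ ↔ (∀ w : W, ξ w < G.deg w) ∧
      ∀ F : Finset V, F.Nonempty → F ⊆ toVerts W →
        ∃ w : W, (w : V) ∈ F ∧ (G.edgesTo w F).card ≤ ξ w := by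
  constructor
  · rintro ⟨η, hη, hr⟩
    obtain ⟨hs, ha⟩ := (recurrent_iff hloop hconn hbdry).1 hη
    refine ⟨fun w => hr w ▸ hs w, fun F hF hFW => ?_⟩
    obtain ⟨v, hv, hle⟩ := ha F hF (disjoint_toVerts_bdry.mono_left hFW)
    have hvW := coe_mem_toVerts.1 (hFW hv)
    exact ⟨⟨v, hvW⟩, hv, hr ⟨v, hvW⟩ ▸ hle⟩
  · rintro ⟨hs, ha⟩
    -- Outside `W`, the largest stable heights are the best choice.
    let η : G.Interior → ℕ := fun v => if h : v ∈ W then ξ ⟨v, h⟩ else G.deg v - 1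
    have hηW : ∀ w : W, η w = ξ w := fun w => dif_pos w.2
    have hη : ∀ v ∉ W, η v = G.deg v - 1 := fun v hv => dif_neg hv
    refine ⟨η, (recurrent_iff hloop hconn hbdry).2 ⟨fun v => ?_, fun F hF hd => ?_⟩, hηW⟩
    · by_cases hv : v ∈ W
      · exact (hηW ⟨v, hv⟩).trans_lt (hs ⟨v, hv⟩)
      · exact (hη v hv).trans_lt (Nat.sub_one_lt (deg_pos hconn hbdry v).ne')
    · by_cases hFW : F ⊆ toVerts W
      · obtain ⟨w, hw, hle⟩ := ha F hF hFW
        exact ⟨w, hw, hle.trans_eq (hηW w).symm⟩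
      · obtain ⟨x, hx, hxW⟩ := Finset.not_subset.1 hFW
        obtain ⟨b, hb, p, hp⟩ := hW x hxW
        obtain ⟨v, hv, hvp, hne⟩ :=
          exists_edgesTo_compl_of_walk p hx (Finset.disjoint_right.1 hd hb)
        have hvW : (⟨v, Finset.disjoint_left.1 hd hv⟩ : G.Interior) ∉ W :=
          fun h => hp v hvp (coe_mem_toVerts.2 h)
        refine ⟨⟨v, Finset.disjoint_left.1 hd hv⟩, hv, ?_⟩
        rw [hη _ hvW]
        exact Nat.le_sub_one_of_lt (card_edgesTo_lt_deg hne)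

-- Otherwise the height of `w` could be decreased: the first vertex of a set `F ⊆ W` to burn still
-- satisfies the burning inequality within `F`.
theorem IsMinimal.mem_toVerts_of_edge (hloop : ∀ e, G.src e ≠ G.tgt e) (hconn : G.IsConn)
    (hbdry : G.bdry.Nonempty)
    (hW : ∀ v ∉ toVerts W, ∃ b ∈ G.bdry, ∃ p : (G.simple Finset.univ).Walk v b,
      ∀ x ∈ p.support, x ∉ toVerts W)
    (hξ : G.IsMinimal ξ) (hη : G.Recurrent η) (hr : RestrictsTo η ξ) {U o c : Finset V} {w : W}
    (hs : Stage (G.heightRule η) U w o c) {e : E} {x : V}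
    (he : s(G.src e, G.tgt e) = s((w : V), x)) (hx : x ∉ c) : x ∈ toVerts W := by
  by_contra hxW
  have hec : e ∈ G.edgesTo w cᶜ := mem_edgesTo.2 ⟨x, Finset.mem_compl.2 hx, he⟩
  have hle : (G.edgesTo w cᶜ).card ≤ ξ w := hr w ▸ hs.rule
  have hpos : 0 < ξ w := (Finset.card_pos.2 ⟨e, hec⟩).trans_le hle
  have hext := (extendable_iff hloop hconn hbdry hW).1 hξ.1
  refine hξ.2 w (ξ w - 1) (Nat.sub_one_lt hpos.ne')
    ((extendable_iff hloop hconn hbdry hW).2 ⟨fun v => ?_, fun F hF hFW => ?_⟩)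
  · exact (update_le_self_iff.2 (Nat.sub_le _ _) v).trans_lt (hext.1 v)
  obtain ⟨v, hv, o', c', hs', hd⟩ := ((recurrent_iff_isIgnition hloop hconn hbdry).1
    hη).exists_stage_disjoint U hF (disjoint_toVerts_bdry.mono_left hFW)
  have hsub : G.edgesTo v F ⊆ G.edgesTo v c'ᶜ :=
    edgesTo_mono (v : V) (Finset.subset_compl_iff_disjoint_right.2 hd)
  have hvW : v ∈ W := coe_mem_toVerts.1 (hFW hv)
  refine ⟨⟨v, hvW⟩, hv, ?_⟩
  obtain rfl | hne := eq_or_ne (⟨v, hvW⟩ : W) w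
  · obtain ⟨-, rfl⟩ := hs.eq hs'
    rw [Function.update_self]
    refine Nat.le_sub_one_of_lt (lt_of_lt_of_le (Finset.card_lt_card ?_) hle)
    refine (Finset.ssubset_iff_of_subset hsub).2 ⟨e, hec, fun heF => ?_⟩
    obtain ⟨y, hy, hey⟩ := mem_edgesTo.1 heF
    exact hxW (Sym2.congr_right.1 (he.symm.trans hey) ▸ hFW hy)
  · rw [Function.update_of_ne hne, ← hr ⟨v, hvW⟩]
    exact (Finset.card_le_card hsub).trans hs'.rule

theorem IsMinimal.burntOut_eq (hloop : ∀ e, G.src e ≠ G.tgt e) (hconn : G.IsConn)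
    (hbdry : G.bdry.Nonempty)
    (hW : ∀ v ∉ toVerts W, ∃ b ∈ G.bdry, ∃ p : (G.simple Finset.univ).Walk v b,
      ∀ x ∈ p.support, x ∉ toVerts W)
    (hξ : G.IsMinimal ξ) (hη : G.Recurrent η) (hr : RestrictsTo η ξ) :
    burntOut (G.heightRule η) (toVerts W)ᶜ G.bdry = (toVerts W)ᶜ := by
  have hR := (recurrent_iff_isIgnition hloop hconn hbdry).1 hη
  set X := burntOut (G.heightRule η) (toVerts W)ᶜ G.bdry
  refine (burntOut_subset bdry_subset_compl_toVerts).antisymm ?_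
  rw [← Finset.sdiff_eq_empty_iff_subset, ← Finset.not_nonempty_iff_eq_empty]
  intro hF
  obtain ⟨v, hv, o, c, hs, hd⟩ := hR.exists_stage_disjoint (toVerts W)ᶜ hF
    (Finset.sdiff_disjoint.mono_right subset_burntOut)
  obtain ⟨hvW, hvX⟩ := Finset.mem_sdiff.1 hv
  -- At least one neighbour `w` of `v` burns before `v`, but only in the second phase.
  obtain ⟨e, he⟩ : (G.edgesTo v (c \ X)).Nonempty := by
    have hX : ¬ G.heightRule η v X := fun h => hvX (mem_burntOut_of_rule hvW h)
    have hXc : X ⊆ c := (hs.burntOut_subset (heightRule_mono v) hvW hvX).trans hs.subset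
    have hcard := card_edgesTo_compl_add_sdiff (G := G) (v : V) hXc
    have hc := hs.rule
    rw [heightRule] at hX hc
    exact Finset.card_pos.1 (by omega)
  obtain ⟨w, hw, he⟩ := mem_edgesTo.1 he
  obtain ⟨hwc, hwX⟩ := Finset.mem_sdiff.1 hw
  have hwW : w ∈ toVerts W := by
    by_contra h
    exact Finset.disjoint_left.1 hd (Finset.mem_sdiff.2 ⟨Finset.mem_compl.2 h, hwX⟩) hwc
  obtain ⟨w, hmem, rfl⟩ := Finset.mem_map.1 hwW
  obtain ⟨o', c', hs'⟩ := hR.exists_stage (toVerts W)ᶜ w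
  have hvc' : (v : V) ∉ c' := fun h => hs.notMem (hs.subset_of_mem hs' hwc h)
  exact Finset.mem_compl.1 hvW (hξ.mem_toVerts_of_edge hloop hconn hbdry hW hη hr (w := ⟨w, hmem⟩)
    hs' (he.trans Sym2.eq_swap) hvc')

end Minimal

section Probability

variable {V E : Type*} [Fintype V] [DecidableEq V] [Fintype E] [DecidableEq E]
  {G : WeightedGraph V E} {W : Finset G.Interior} {η η' : G.Interior → ℕ} {ξ : W → ℕ}
  {rank : G.Interior → E → ℕ}

theorem isSpanningTree_burningMap_inter_iff
    (hrank : ∀ v : G.Interior, Set.InjOn (rank v) (G.edgesTo (v : V) Finset.univ))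
    (hR : IsIgnition (G.heightRule η)) :
    (G.wiredOff W).IsSpanningTree (G.burningMap rank W η ∩ G.edgesAt W) ↔
      burntOut (G.heightRule η) (toVerts W)ᶜ G.bdry = (toVerts W)ᶜ := by
  obtain ⟨f, p, h⟩ := exists_isSelection hrank hR (toVerts W)ᶜ
  rw [h.burntOut_eq_iff hR bdry_subset_compl_toVerts, h.burningMap_eq hrank hR,
    edgesAt_eq_edgesOff,
    (h.isParentMap hR).isSpanningTree_inter_edgesOff_iff bdry_subset_compl_toVerts]

theorem restrictsTo_iff_burningMap_inter_eq
    (hrank : ∀ v : G.Interior, Set.InjOn (rank v) (G.edgesTo (v : V) Finset.univ))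
    (hR : IsIgnition (G.heightRule η)) (hR' : IsIgnition (G.heightRule η'))
    (hU : burntOut (G.heightRule η) (toVerts W)ᶜ G.bdry = (toVerts W)ᶜ)
    (hU' : burntOut (G.heightRule η') (toVerts W)ᶜ G.bdry = (toVerts W)ᶜ)
    (hr' : RestrictsTo η' ξ) :
    RestrictsTo η ξ ↔
      G.burningMap rank W η ∩ G.edgesAt W = G.burningMap rank W η' ∩ G.edgesAt W := by
  obtain ⟨f, p, h⟩ := exists_isSelection hrank hR (toVerts W)ᶜ
  obtain ⟨f', p', h'⟩ := exists_isSelection hrank hR' (toVerts W)ᶜ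
  rw [h.burningMap_eq hrank hR, h'.burningMap_eq hrank hR', edgesAt_eq_edgesOff,
    ← h.restrictOff_eq_iff hrank h' hR hR' bdry_subset_compl_toVerts hU hU',
    restrictOff_eq_iff hr']

theorem IsMinimal.restrictsTo_iff (hloop : ∀ e, G.src e ≠ G.tgt e) (hconn : G.IsConn)
    (hbdry : G.bdry.Nonempty)
    (hrank : ∀ v : G.Interior, Set.InjOn (rank v) (G.edgesTo (v : V) Finset.univ))
    (hW : ∀ v ∉ toVerts W, ∃ b ∈ G.bdry, ∃ p : (G.simple Finset.univ).Walk v b,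
      ∀ x ∈ p.support, x ∉ toVerts W)
    (hξ : G.IsMinimal ξ) (hη : G.Recurrent η) (hη' : G.Recurrent η') (hr' : RestrictsTo η' ξ) :
    RestrictsTo η ξ ↔
      G.burningMap rank W η ∩ G.edgesAt W = G.burningMap rank W η' ∩ G.edgesAt W := by
  have hR := (recurrent_iff_isIgnition hloop hconn hbdry).1 hη
  have hR' := (recurrent_iff_isIgnition hloop hconn hbdry).1 hη'
  have hU' := hξ.burntOut_eq hloop hconn hbdry hW hη' hr'
  refine ⟨fun hr => ?_, fun heq => ?_⟩
  · have hU := hξ.burntOut_eq hloop hconn hbdry hW hη hr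
    exact (restrictsTo_iff_burningMap_inter_eq hrank hR hR' hU hU' hr').1 hr
  · have hU := (isSpanningTree_burningMap_inter_iff hrank hR).1
      (heq ▸ (isSpanningTree_burningMap_inter_iff hrank hR').2 hU')
    exact (restrictsTo_iff_burningMap_inter_eq hrank hR hR' hU hU' hr').2 heq

theorem sandpileProb_eq_div
    (hbij : Set.BijOn (G.burningMap rank W) {η | G.Recurrent η} {A | G.wired.IsSpanningTree A})
    {T : Finset E} (h : ∀ η, G.Recurrent η →
      (RestrictsTo η ξ ↔ G.burningMap rank W η ∩ G.edgesAt W = T)) :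
    G.sandpileProb rank ξ =
      (∑ A ∈ G.wired.spanningTrees with A ∩ G.edgesAt W = T, G.weight A) / G.wired.treeSum := by
  classical
  rw [sandpileProb, ← Finset.sum_div]
  congr 1
  refine Finset.sum_nbij (G.burningMap rank W) (fun η hη => ?_) ?_ (fun A hA => ?_) fun _ _ => rfl
  · rw [Finset.mem_filter, mem_recurrentConfigs] at hη
    exact Finset.mem_filter.2 ⟨mem_spanningTrees.2 (hbij.mapsTo hη.1), (h η hη.1).1 hη.2⟩
  · refine hbij.injOn.mono fun η hη => ?_
    exact mem_recurrentConfigs.1 (Finset.mem_filter.1 hη).1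
  · obtain ⟨htree, hT⟩ := Finset.mem_filter.1 hA
    obtain ⟨η, hη, rfl⟩ := hbij.surjOn (mem_spanningTrees.1 htree)
    exact ⟨η, Finset.mem_filter.2 ⟨mem_recurrentConfigs.2 hη, (h η hη).2 hT⟩, rfl⟩

end Probability

end WeightedGraph

theorem proposition4p3 {V E : Type*} [Fintype V] [Fintype E] [DecidableEq V] [DecidableEq E]
    (G : WeightedGraph V E)
    (hloop : ∀ e, G.src e ≠ G.tgt e)
    (hconn : G.IsConn)
    (hbdry : G.bdry.Nonempty)
    -- an ordering of the edges around each interior vertex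
    (rank : G.Interior → E → ℕ)
    (hrank : ∀ v : G.Interior,
      Set.InjOn (rank v) (G.edgesTo (v : V) Finset.univ : Set E))
    (W : Finset G.Interior)
    -- every vertex outside `W` is joined to the boundary by a path that avoids `W`
    (hW : ∀ v ∉ WeightedGraph.toVerts W, ∃ b ∈ G.bdry,
      ∃ p : (G.simple Finset.univ).Walk v b, ∀ x ∈ p.support, x ∉ WeightedGraph.toVerts W) :
    -- the burning map is a bijection from recurrent configurations to wired spanning trees
    Set.BijOn (G.burningMap rank W) {η | G.Recurrent η} {A | G.wired.IsSpanningTree A} ∧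
    ∀ ξ : W → ℕ, G.IsMinimal ξ →
      ∃ T₀ : Finset E, (G.wiredOff W).IsSpanningTree T₀ ∧
        (∀ η, G.Recurrent η → WeightedGraph.RestrictsTo η ξ →
          G.burningMap rank W η ∩ G.edgesAt W = T₀) ∧
        G.sandpileProb rank ξ = G.detCompl (G.edgesAt W \ T₀) ∧
        G.sandpileProb rank ξ =
          ∑ T ∈ (G.wiredOff W).spanningTrees,
            (G.wiredOff W).weight T₀ / (G.wiredOff W).treeSum *
              G.detCompl (G.edgesAt W \ T) := by
  have hbij := WeightedGraph.bijOn_burningMap hloop hconn hbdry hrank W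
  refine ⟨hbij, fun ξ hξ => ?_⟩
  obtain ⟨η₀, hη₀, hr₀⟩ := hξ.1
  have hiff : ∀ η, G.Recurrent η → (WeightedGraph.RestrictsTo η ξ ↔
      G.burningMap rank W η ∩ G.edgesAt W = G.burningMap rank W η₀ ∩ G.edgesAt W) :=
    fun η hη => hξ.restrictsTo_iff hloop hconn hbdry hrank hW hη hη₀ hr₀
  have hT₀ : (G.wiredOff W).IsSpanningTree (G.burningMap rank W η₀ ∩ G.edgesAt W) :=
    (WeightedGraph.isSpanningTree_burningMap_inter_iff hrank
      ((WeightedGraph.recurrent_iff_isIgnition hloop hconn hbdry).1 hη₀)).2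
      (hξ.burntOut_eq hloop hconn hbdry hW hη₀ hr₀)
  have hZ : G.wired.treeSum ≠ 0 := (WeightedGraph.treeSum_pos (hbij.mapsTo hη₀)).ne'
  have hU : G.bdry ⊆ (WeightedGraph.toVerts W)ᶜ := WeightedGraph.bdry_subset_compl_toVerts
  have hprob := WeightedGraph.sandpileProb_eq_div hbij hiff
  rw [WeightedGraph.edgesAt_eq_edgesOff] at hT₀ hprob hiff ⊢
  rw [← WeightedGraph.detCompl_edgesOff_sdiff hloop hZ hU hT₀] at hprob
  refine ⟨_, hT₀, fun η hη hr => (hiff η hη).1 hr, hprob, ?_⟩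
  rw [hprob, WeightedGraph.detCompl_edgesOff_sdiff_eq_sum hloop hZ hU hT₀]
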